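/- Let $d\ge 1$ and let $P_0,\dots,P_{d-1}\in\mathbb R^{d-1}$ be affinely independent. Put $f_i(X)=\frac12(X+P_i)$, $0\le i\le d-1$, and let $K$ be the Sierpiński simplex, the unique nonempty compact set with $K=\bigcup_i f_i(K)$. Let $V_0=\{P_0,\dots,P_{d-1}\}$ and $V_m=\bigcup_i f_i(V_{m-1})$ for $m\ge 1$. Write $X\sim_m Y$ if $X\ne Y$ are two points of $f_w(V_0)$ for a common word $w$ of length $m$ (where $f_w=f_{w_1}\circ\cdots\circ f_{w_m}$), and let $\Delta_m v(X)=\sum_{Y\sim_m X}(v(Y)-v(X))$. Let $\mu$ be the self-similar probability measure on $K$ with equal weights $1/d$, let $r=\frac{d}{d+2}$, and for $X\in V_m\setminus V_0$ let $\psi^{(m)}_X$ be the harmonic spline of order $m$: the continuous function on $K$ with $\psi^{(m)}_X(X)=1$, $\psi^{(m)}_X=0$ on $V_m\setminus\{X\}$, and $\Delta_n\psi^{(m)}_X=0$ on $V_n\setminus V_m$ for all $n>m$. For continuous $v,w:K\to\mathbb R$ write $\Delta v=w$ if $$\lim_{m\to\infty}r^{-m}\Big(\int_K\psi^{(m)}_{X_m}\,d\mu\Big)^{-1}\Delta_m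 v(X_m)=w(x)$$ for every $x\in K$ and every sequence $X_m\in V_m\setminus V_0$ ($m\ge 1$) with $X_m\to x$. Let $T>0$, let $g:K\to\mathbb R$, and let $u:[0,T]\times K\to\mathbb R$, continuous in $t\in[0,T]$ for each $x\in K$, be a solution of the heat equation: for every $t\in(0,T)$, $u(\cdot,x)$ is differentiable at $t$ for all $x\in K$ and $\partial_t u(t,\cdot)=\Delta u(t,\cdot)$ on $K$; $u(t,x)=0$ for $t\in[0,T)$ and $x\in V_0$; $u(0,\cdot)=g$ on $K$. For $m\ge 0$ and $N\ge 1$ let $h=T/N$ and let $u_h^m$ be the solution of the explicit Euler scheme $$\frac{u_h^m((k+1)h,X)-u_h^m(kh,X)}{h}=\frac d2(d+2)^m\Delta_m u_h^m(kh,X)\quad(0\le k\le N-1,\ X\in V_m\setminus V_0),$$ $$u_h^m(kh,P_j)=0,\qquad u_h^m(0,X)=g(X)\quad(X\in V_m\setminus V_0).$$ For $0\le k\le N-1$ and $X\in V_m\setminus V_0$ let $$\varepsilon^m_k(X)=\frac{u((k+1)h,X)-u(kh,X)}{h}-\frac d2(d+2)^m\Delta_m u(kh,X)$$ be the consistency error,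 and put $\varepsilon^m_k=0$ on $V_0$. For a family $(w^k)_k$ of functions on $V_m$ let $\|w\|_{2,\infty}=\max_k\big(d^{-m}\sum_{X\in V_m}|w^k(X)|^2\big)^{1/2}$, where $k$ runs over $0\le k\le N$ for the error $u(kh,\cdot)-u_h^m(kh,\cdot)$ and over $0\le k\le N-1$ for $\varepsilon^m$. All limits below are taken as $m\to\infty$ over the pairs $(m,N)$ that satisfy the CFL condition $h(d+2)^m\le \frac{2}{d^2}$ (so that $h\to0$ as well). Then: 1. If $\|\varepsilon^m\|_{2,\infty}\to 0$ (the scheme is consistent for $u$), then $\|u-u_h^m\|_{2,\infty}\to0$ (the scheme is convergent). 2. Let $\alpha>0$ and suppose that $\Delta u$ is $\alpha$-Hölder in space, uniformly in time, i.e. $|\Delta u(t,x)-\Delta u(t,y)|\le H|x-y|^\alpha$ for all $t\in(0,T)$ and $x,y\in K$, and that $\partial_t u$ is Lipschitz in time, uniformly in space, i.e. $|\partial_t u(s,x)-\partial_t u(t,x)|\le M|s-t|$ for all $s,t\in(0,T)$ and $x\in K$. Then there is a constant $C$, independent of $m$ and $N$, such that for all $m\ge 0$ and $N\ge1$ we have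 $|\varepsilon^m_k(X)|\le C\,(h+2^{-m\alpha})$ for all $0\le k\le N-1$ and $X\in V_m\setminus V_0$, and, if the CFL condition $h(d+2)^m\le\frac2{d^2}$ holds, then $$\|u-u_h^m\|_{2,\infty}\le C\,(h+2^{-m\alpha}).$$ In particular $\|u-u_h^m\|_{2,\infty}\to0$. -/

import Mathlib

open Set Filter Topology MeasureTheory

noncomputable section

namespace SierpinskiHeat

/-- The Euclidean space `ℝ^{d-1}` in which the simplex with `d` vertices lives. -/
abbrev Ambient (d : ℕ) : Type := EuclideanSpace ℝ (Fin (d - 1))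

variable {d : ℕ}

/-! ### The Sierpinski simplex and its graphs -/

/-- The contraction `X ↦ (X + P i) / 2` with fixed point `P i`. -/
def contraction (P : Fin d → Ambient d) (i : Fin d) (x : Ambient d) : Ambient d :=
  (2⁻¹ : ℝ) • (x + P i)

/-- `f_w = f_{w_1} ∘ ⋯ ∘ f_{w_m}` for a finite word `w`. -/
def wordMap (P : Fin d → Ambient d) : List (Fin d) → Ambient d → Ambient d
  | [] => id
  | i :: w => contraction P i ∘ wordMap P w

/-- The point with infinite address `ω`, the limit of `f_{ω 0} ∘ ⋯ ∘ f_{ω n}` as `n → ∞`. -/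
def address (P : Fin d → Ambient d) (ω : ℕ → Fin d) : Ambient d :=
  ∑' n, ((2⁻¹ : ℝ) ^ (n + 1)) • P (ω n)

/-- The Sierpinski simplex; `simplex_eq_iff` says that it is the unique nonempty compact set that
is the union of its images under the contractions. -/
def simplex (P : Fin d → Ambient d) : Set (Ambient d) := Set.range (address P)

theorem summable_address (P : Fin d → Ambient d) (ω : ℕ → Fin d) :
    Summable fun n => ((2⁻¹ : ℝ) ^ (n + 1)) • P (ω n) := by
  refine Summable.of_norm_bounded (g := fun n => (2⁻¹ : ℝ) ^ n * ∑ i, ‖P i‖)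
    ((summable_geometric_of_lt_one (by norm_num) (by norm_num)).mul_right _) fun n => ?_
  have h1 : ‖P (ω n)‖ ≤ ∑ i, ‖P i‖ :=
    Finset.single_le_sum (f := fun i => ‖P i‖) (fun i _ => norm_nonneg _) (Finset.mem_univ _)
  rw [norm_smul, Real.norm_of_nonneg (by positivity)]
  have h2 : (2⁻¹ : ℝ) ^ (n + 1) ≤ 2⁻¹ ^ n :=
    pow_le_pow_of_le_one (by norm_num) (by norm_num) (Nat.le_succ n)
  gcongr

theorem continuous_address (P : Fin d → Ambient d) : Continuous (address P) := by
  refine continuous_tsum (u := fun n => (2⁻¹ : ℝ) ^ n * ∑ i, ‖P i‖) (fun n => ?_)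
    ((summable_geometric_of_lt_one (by norm_num) (by norm_num)).mul_right _) fun n ω => ?_
  · have h1 : Continuous fun ω : ℕ → Fin d => ω n := continuous_apply n
    have h2 : Continuous P := continuous_of_discreteTopology
    exact (h2.comp h1).const_smul ((2⁻¹ : ℝ) ^ (n + 1))
  · have h1 : ‖P (ω n)‖ ≤ ∑ i, ‖P i‖ :=
      Finset.single_le_sum (f := fun i => ‖P i‖) (fun i _ => norm_nonneg _) (Finset.mem_univ _)
    rw [norm_smul, Real.norm_of_nonneg (by positivity)]
    have h2 : (2⁻¹ : ℝ) ^ (n + 1) ≤ 2⁻¹ ^ n :=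
      pow_le_pow_of_le_one (by norm_num) (by norm_num) (Nat.le_succ n)
    gcongr

theorem address_eq (P : Fin d → Ambient d) (ω : ℕ → Fin d) :
    address P ω = contraction P (ω 0) (address P fun n => ω (n + 1)) := by
  have h := (summable_address P ω).tsum_eq_zero_add
  have h' := (summable_address P fun n => ω (n + 1)).tsum_const_smul (2⁻¹ : ℝ)
  simp only [address, contraction]
  rw [h, smul_add, ← h', add_comm]
  simp [pow_succ', smul_smul]

theorem simplex_eq_iUnion (P : Fin d → Ambient d) :
    simplex P = ⋃ i, contraction P i '' simplex P := by
  ext x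
  simp only [simplex, Set.mem_range, Set.mem_iUnion, Set.mem_image, exists_exists_eq_and]
  constructor
  · rintro ⟨ω, rfl⟩
    exact ⟨ω 0, fun n => ω (n + 1), (address_eq P ω).symm⟩
  · rintro ⟨i, ω, rfl⟩
    let ω' : ℕ → Fin d := fun n => Nat.casesOn n i ω
    have h := address_eq P ω'
    exact ⟨ω', h⟩

/-- Two nonempty compact sets that are the unions of their images under the contractions are
contained in each other. -/
theorem subset_of_selfSimilar (P : Fin d → Ambient d) {K L : Set (Ambient d)}
    (hK : IsCompact K) (hKs : K = ⋃ i, contraction P i '' K)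
    (hL : IsCompact L) (hLne : L.Nonempty) (hLs : L = ⋃ i, contraction P i '' L) : K ⊆ L := by
  intro x hx
  obtain ⟨x₀, hx₀, hmax⟩ :=
    hK.exists_isMaxOn ⟨x, hx⟩ (Metric.continuous_infDist_pt L).continuousOn
  have h0 : x₀ ∈ ⋃ i, contraction P i '' K := hKs ▸ hx₀
  obtain ⟨i, y, hy, rfl⟩ := by simpa only [Set.mem_iUnion, Set.mem_image] using h0
  obtain ⟨z, hz, hyz⟩ := hL.exists_infDist_eq_dist hLne y
  have hz' : contraction P i z ∈ L := by
    rw [hLs]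
    exact Set.mem_iUnion.2 ⟨i, z, hz, rfl⟩
  have h1 : Metric.infDist (contraction P i y) L ≤ 2⁻¹ * Metric.infDist y L := by
    refine (Metric.infDist_le_dist_of_mem hz').trans ?_
    rw [hyz, contraction, contraction, dist_smul₀, dist_add_right]
    norm_num
  have h2 : Metric.infDist y L ≤ Metric.infDist (contraction P i y) L := hmax hy
  have h3 : Metric.infDist x L ≤ Metric.infDist (contraction P i y) L := hmax hx
  have h4 : Metric.infDist x L = 0 :=
    le_antisymm (by linarith) Metric.infDist_nonneg
  exact (hL.isClosed.mem_iff_infDist_zero hLne).2 h4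

theorem simplex_eq_iff [NeZero d] (P : Fin d → Ambient d) (K : Set (Ambient d)) :
    K = simplex P ↔ IsCompact K ∧ K.Nonempty ∧ K = ⋃ i, contraction P i '' K := by
  have hc : IsCompact (simplex P) := isCompact_range (continuous_address P)
  have hne : (simplex P).Nonempty := ⟨_, fun _ => 0, rfl⟩
  constructor
  · rintro rfl
    exact ⟨hc, hne, simplex_eq_iUnion P⟩
  · rintro ⟨h1, h2, h3⟩
    exact (subset_of_selfSimilar P h1 h3 hc hne (simplex_eq_iUnion P)).antisymm
      (subset_of_selfSimilar P hc (simplex_eq_iUnion P) h1 h2 h3)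

open Classical in
/-- The vertex set `V_m`: `V_0 = {P_0, …, P_{d-1}}` and `V_{m+1} = ⋃ i, f_i (V_m)`. -/
def vertices (P : Fin d → Ambient d) : ℕ → Finset (Ambient d)
  | 0 => Finset.univ.image P
  | m + 1 => Finset.univ.biUnion fun i => (vertices P m).image (contraction P i)

open Classical in
/-- The interior vertices `V_m \ V_0`. -/
def interiorVertices (P : Fin d → Ambient d) (m : ℕ) : Finset (Ambient d) :=
  vertices P m \ vertices P 0

/-- The relation `X ∼_m Y`: `X` and `Y` are distinct vertices of a common cell of order `m`. -/
def Adj (P : Fin d → Ambient d) (m : ℕ) (X Y : Ambient d) : Prop :=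
  X ≠ Y ∧ ∃ w : List (Fin d), w.length = m ∧
    ∃ i j : Fin d, X = wordMap P w (P i) ∧ Y = wordMap P w (P j)

open Classical in
/-- The graph Laplacian `Δ_m v (X) = ∑_{Y ∈ V_m, Y ∼_m X} (v Y - v X)`. -/
def graphLaplacian (P : Fin d → Ambient d) (m : ℕ) (v : Ambient d → ℝ) (X : Ambient d) : ℝ :=
  ∑ Y ∈ (vertices P m).filter (Adj P m X), (v Y - v X)

/-! ### The Laplacian on the simplex -/

/-- The standard self-similar probability measure `μ = (1/d) ∑ i, μ ∘ f_i⁻¹`: the law of the point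
whose address consists of independent uniform letters. -/
def selfSimilarMeasure [NeZero d] (P : Fin d → Ambient d) : Measure (Ambient d) :=
  (Measure.infinitePi fun _ : ℕ => (PMF.uniformOfFintype (Fin d)).toMeasure).map (address P)

/-- `ψ` is the harmonic spline `ψ_X^{(m)}`: it is continuous on the simplex, equals `1` at `X` and
`0` at the other points of `V_m`, and is graph harmonic at all later vertices. These conditions
determine it on the simplex. -/
structure IsHarmonicSpline (P : Fin d → Ambient d) (m : ℕ) (X : Ambient d)
    (ψ : Ambient d → ℝ) : Prop where
  continuousOn : ContinuousOn ψ (simplex P)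
  eq_one : ψ X = 1
  eq_zero : ∀ Y ∈ vertices P m, Y ≠ X → ψ Y = 0
  harmonic : ∀ n, m < n → ∀ Y ∈ vertices P n, Y ∉ vertices P m → graphLaplacian P n ψ Y = 0

/-- The renormalization ratio `r = d / (d + 2)` of the energy on the simplex. -/
def energyRatio (d : ℕ) : ℝ := (d : ℝ) / (d + 2)

/-- `v` is in the domain of the Laplacian and `Δ v = f`: both are continuous on the simplex and
`r^{-m} (∫ ψ_{X_m}^{(m)} dμ)⁻¹ Δ_m v (X_m) → f x` whenever `X_m ∈ V_m \ V_0` tends to `x`.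
There are no interior vertices of order `0`, so the sequences start at `m = 1`. -/
structure HasLaplacian [NeZero d] (P : Fin d → Ambient d) (v f : Ambient d → ℝ) : Prop where
  continuousOn : ContinuousOn v (simplex P)
  continuousOn_laplacian : ContinuousOn f (simplex P)
  tendsto : ∀ x ∈ simplex P, ∀ X : ℕ → Ambient d,
    (∀ m, 1 ≤ m → X m ∈ interiorVertices P m) → Tendsto X atTop (𝓝 x) →
    ∃ ψ : ℕ → Ambient d → ℝ, (∀ m, 1 ≤ m → IsHarmonicSpline P m (X m) (ψ m)) ∧
      Tendsto (fun m => (energyRatio d ^ m)⁻¹ * (∫ y, ψ m y ∂(selfSimilarMeasure P))⁻¹ *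
        graphLaplacian P m v (X m)) atTop (𝓝 (f x))

/-! ### The heat equation and the explicit scheme -/

/-- `u` solves the heat equation on `]0,T[ × simplex`, with `∂u/∂t = Δu = f` there, vanishes on the
boundary `V_0`, and starts from `g`. -/
structure IsHeatSolution [NeZero d] (P : Fin d → Ambient d) (T : ℝ) (g : Ambient d → ℝ)
    (u f : ℝ → Ambient d → ℝ) : Prop where
  continuousOn_time : ∀ x ∈ simplex P, ContinuousOn (fun t => u t x) (Icc 0 T)
  time_deriv : ∀ t ∈ Ioo 0 T, ∀ x ∈ simplex P, HasDerivAt (fun s => u s x) (f t x) t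
  laplacian : ∀ t ∈ Ioo 0 T, HasLaplacian P (u t) (f t)
  boundary : ∀ t ∈ Ico 0 T, ∀ x ∈ vertices P 0, u t x = 0
  initial : ∀ x ∈ simplex P, u 0 x = g x

/-- The normalized graph Laplacian `(d/2) (d+2)^m Δ_m`. -/
def normalizedLaplacian (P : Fin d → Ambient d) (m : ℕ) (v : Ambient d → ℝ) (X : Ambient d) : ℝ :=
  (d : ℝ) / 2 * ((d : ℝ) + 2) ^ m * graphLaplacian P m v X

open Classical in
/-- The explicit Euler scheme: `eulerScheme P m h g k X` is `u_h^m (k h, X)` for `X ∈ V_m`. -/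
def eulerScheme (P : Fin d → Ambient d) (m : ℕ) (h : ℝ) (g : Ambient d → ℝ) :
    ℕ → Ambient d → ℝ
  | 0 => fun X => if X ∈ vertices P 0 then 0 else g X
  | k + 1 => fun X => if X ∈ vertices P 0 then 0 else
      eulerScheme P m h g k X + h * normalizedLaplacian P m (eulerScheme P m h g k) X

/-- The error `u (k h, X) - u_h^m (k h, X)`. -/
def schemeError (P : Fin d → Ambient d) (m : ℕ) (h : ℝ) (g : Ambient d → ℝ)
    (u : ℝ → Ambient d → ℝ) (k : ℕ) (X : Ambient d) : ℝ :=
  u (k * h) X - eulerScheme P m h g k X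

open Classical in
/-- The consistency error at the interior vertices (and `0` at the boundary vertices): the residual
of the solution `u` in the explicit scheme. -/
def consistencyError (P : Fin d → Ambient d) (m : ℕ) (h : ℝ)
    (u : ℝ → Ambient d → ℝ) (k : ℕ) (X : Ambient d) : ℝ :=
  if X ∈ vertices P 0 then 0 else
    (u ((k + 1 : ℕ) * h) X - u (k * h) X) / h - normalizedLaplacian P m (u (k * h)) X

/-- `max_{0 ≤ k < K} (d^{-m} ∑_{X ∈ V_m} |w k X|²)^{1/2}`. -/
def normTwoInfty (P : Fin d → Ambient d) (m K : ℕ) (w : ℕ → Ambient d → ℝ) : ℝ :=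
  ⨆ k : Fin K, Real.sqrt (((d : ℝ) ^ m)⁻¹ * ∑ X ∈ vertices P m, |w k X| ^ 2)

/-- The Courant-Friedrichs-Lewy condition `h (d+2)^m ≤ 2 / d²`. -/
def CFL (d m : ℕ) (h : ℝ) : Prop := h * ((d : ℝ) + 2) ^ m ≤ 2 / (d : ℝ) ^ 2

/-- The limit `m → ∞` over the pairs `(m, N)`, `N ≥ 1`, for which `h = T / N` satisfies the CFL
condition (so that `h → 0` as well). -/
def cflLimit (d : ℕ) (T : ℝ) : Filter (ℕ × ℕ) :=
  comap Prod.fst atTop ⊓ 𝓟 {q | 1 ≤ q.2 ∧ CFL d q.1 (T / q.2)}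

end SierpinskiHeat

end

open SierpinskiHeat

/-!
At an interior vertex `X` of order `m` two cells meet, and the sum of a harmonic spline over the
corners of all cells is multiplied by `d` at each refinement. Hence the integral of `ψ_X` is
`2 / d ^ (m + 1)`, and the quotient in the definition of the Laplacian is the normalized Laplacian
`L_m v X = (d / 2) (d + 2) ^ m Δ_m v X`.

Consistency: `d * L_m v X` is a sum with nonnegative weights, of total weight `d`, of the values of
`L_{m+1} v` at vertices of the two cells at `X`. A bound on `L_{m+1} v - Δv` therefore passes to
`L_m v - Δv` at the cost of the oscillation of `Δv` at scale `2 ^ (-m)`. By compactness `L_n v` is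
uniformly close to `Δv` for large `n`, and summing the geometric series of the oscillations gives
the rate `2 ^ (-m α)`; the mean value theorem in time gives the rate `h`.

Stability: on each cell `Δ_m` is the Laplacian `L` of a complete graph on `d` points, for which
`‖L v‖² = -d ⟨v, L v⟩`. As two cells meet at an interior vertex, `‖Δ_m v‖² ≤ -2 d ⟨v, Δ_m v⟩` there,
so under the CFL condition an Euler step is an `ℓ²` contraction. The errors thus accumulate to at
most `T` times the largest consistency error.
-/

noncomputable section

namespace SierpinskiHeat

variable {d : ℕ} {P : Fin d → Ambient d}

/-! ### Words and cells -/

theorem exists_stdSimplex_of_mem_convexHull_range {ι E : Type*} [Fintype ι] [AddCommGroup E]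
    [Module ℝ E] {p : ι → E} {x : E} (hx : x ∈ convexHull ℝ (range p)) :
    ∃ w ∈ stdSimplex ℝ ι, ∑ i, w i • p i = x := by
  classical
  have hrange : range p = Fintype.linearCombination ℝ p '' range fun i => Pi.single i 1 := by
    simp [← range_comp, Function.comp_def]
  rw [hrange, ← LinearMap.image_convexHull, convexHull_rangle_single_eq_stdSimplex] at hx
  exact hx

/-- Two half-size cells of a simplex meet at most in the midpoint of the edge joining their fixed
vertices: comparing barycentric coordinates in `x + p a = y + p b`, that of `p b` on the right is
at least `1`, so on the left `x` must be the vertex `p b`. -/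
theorem eq_vertex_of_add_eq_add {ι E : Type*} [Finite ι] [AddCommGroup E] [Module ℝ E]
    {p : ι → E} (hp : AffineIndependent ℝ p) {x y : E} (hx : x ∈ convexHull ℝ (range p))
    (hy : y ∈ convexHull ℝ (range p)) {a b : ι} (hab : a ≠ b) (h : x + p a = y + p b) :
    x = p b := by
  classical
  have := Fintype.ofFinite ι
  obtain ⟨w, hw, rfl⟩ := exists_stdSimplex_of_mem_convexHull_range hx
  obtain ⟨w', hw', rfl⟩ := exists_stdSimplex_of_mem_convexHull_range hy
  have hcoord := hp.eq_of_sum_eq_sum (s := Finset.univ) (w₁ := w + Pi.single a 1)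
    (w₂ := w' + Pi.single b 1) (by simp [Finset.sum_add_distrib, hw.2, hw'.2])
    (by simpa [add_smul, Finset.sum_add_distrib, Pi.single_apply] using h) b (Finset.mem_univ b)
  have hb : w b = 1 := by
    have : w b = w' b + 1 := by simpa [hab.symm] using hcoord
    exact le_antisymm (mem_Icc_of_mem_stdSimplex hw b).2 (by linarith [hw'.1 b])
  have hrest : ∀ i ≠ b, w i = 0 := by
    have hsum : ∑ i ∈ Finset.univ.erase b, w i = 0 := by
      linarith [Finset.add_sum_erase Finset.univ w (Finset.mem_univ b), hw.2]
    intro i hi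
    exact (Finset.sum_eq_zero_iff_of_nonneg fun j _ => hw.1 j).1 hsum i (by simpa using hi)
  rw [Finset.sum_eq_single b (fun i _ hi => by rw [hrest i hi, zero_smul]) (by simp), hb, one_smul]

theorem contraction_self (P : Fin d → Ambient d) (i : Fin d) : contraction P i (P i) = P i := by
  rw [contraction, ← two_smul ℝ (P i), inv_smul_smul₀ two_ne_zero]

theorem contraction_comm (P : Fin d → Ambient d) (i j : Fin d) :
    contraction P i (P j) = contraction P j (P i) := by
  rw [contraction, contraction, add_comm]

theorem contraction_mem_convexHull (i : Fin d) {x : Ambient d}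
    (hx : x ∈ convexHull ℝ (range P)) : contraction P i x ∈ convexHull ℝ (range P) := by
  have h := (convex_convexHull ℝ _).midpoint_mem hx (subset_convexHull ℝ _ (mem_range_self i))
  rwa [midpoint_eq_smul_add, invOf_eq_inv] at h

theorem contraction_eq_contraction (hP : AffineIndependent ℝ P) {a b : Fin d} (hab : a ≠ b)
    {x y : Ambient d} (hx : x ∈ convexHull ℝ (range P)) (hy : y ∈ convexHull ℝ (range P))
    (h : contraction P a x = contraction P b y) : x = P b ∧ y = P a := by
  have h' : x + P a = y + P b := smul_right_injective _ (by norm_num : (2⁻¹ : ℝ) ≠ 0) h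
  exact ⟨eq_vertex_of_add_eq_add hP hx hy hab h', eq_vertex_of_add_eq_add hP hy hx hab.symm h'.symm⟩

theorem dist_contraction (i : Fin d) (x y : Ambient d) :
    dist (contraction P i x) (contraction P i y) = 2⁻¹ * dist x y := by
  rw [contraction, contraction, dist_smul₀, dist_add_right, Real.norm_of_nonneg (by norm_num)]

theorem contraction_injective (P : Fin d → Ambient d) (i : Fin d) :
    Function.Injective (contraction P i) := fun _ _ h =>
  add_right_cancel (smul_right_injective _ (by norm_num : (2⁻¹ : ℝ) ≠ 0) h)

theorem wordMap_append (P : Fin d → Ambient d) (u w : List (Fin d)) (x : Ambient d) :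
    wordMap P (u ++ w) x = wordMap P u (wordMap P w x) := by
  induction u with
  | nil => rfl
  | cons a u ih => simp [wordMap, ih]

theorem dist_wordMap (w : List (Fin d)) (x y : Ambient d) :
    dist (wordMap P w x) (wordMap P w y) = (2⁻¹ : ℝ) ^ w.length * dist x y := by
  induction w with
  | nil => simp [wordMap]
  | cons a w ih => simp [wordMap, dist_contraction, ih, pow_succ', mul_assoc]

theorem wordMap_injective (P : Fin d → Ambient d) (w : List (Fin d)) :
    Function.Injective (wordMap P w) := by
  induction w with
  | nil => exact Function.injective_id
  | cons a w ih => exact (contraction_injective P a).comp ih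

theorem wordMap_mem_convexHull (w : List (Fin d)) {x : Ambient d}
    (hx : x ∈ convexHull ℝ (range P)) : wordMap P w x ∈ convexHull ℝ (range P) := by
  induction w with
  | nil => exact hx
  | cons a w ih => exact contraction_mem_convexHull a ih

theorem wordMap_vertex_mem_convexHull (w : List (Fin d)) (i : Fin d) :
    wordMap P w (P i) ∈ convexHull ℝ (range P) :=
  wordMap_mem_convexHull w (subset_convexHull ℝ _ (mem_range_self i))

theorem eq_replicate_of_wordMap_eq_vertex (hP : AffineIndependent ℝ P) {w : List (Fin d)}
    {x : Ambient d} (hx : x ∈ convexHull ℝ (range P)) {j : Fin d} (h : wordMap P w x = P j) :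
    w = List.replicate w.length j ∧ x = P j := by
  induction w with
  | nil => exact ⟨rfl, h⟩
  | cons a w ih =>
    have h' : contraction P a (wordMap P w x) = contraction P j (P j) := by
      rw [contraction_self]
      exact h
    have haj : a = j := by
      by_contra haj
      exact haj (hP.injective (contraction_eq_contraction hP haj (wordMap_mem_convexHull w hx)
        (wordMap_vertex_mem_convexHull [] j) h').2.symm)
    subst haj
    obtain ⟨hw, rfl⟩ := ih (contraction_injective P a h')
    exact ⟨by rw [List.length_cons, List.replicate_succ, ← hw], rfl⟩

theorem eq_of_wordMap_eq_of_ne (hP : AffineIndependent ℝ P) {w w' : List (Fin d)}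
    (hl : w.length = w'.length) {x y x' y' : Ambient d} (hx : x ∈ convexHull ℝ (range P))
    (hy : y ∈ convexHull ℝ (range P)) (hx' : x' ∈ convexHull ℝ (range P))
    (hy' : y' ∈ convexHull ℝ (range P)) (hxy : x ≠ y) (hxx' : wordMap P w x = wordMap P w' x')
    (hyy' : wordMap P w y = wordMap P w' y') : w = w' := by
  induction w generalizing w' with
  | nil => exact (List.length_eq_zero_iff.1 hl.symm).symm
  | cons a w ih =>
    obtain ⟨b, w', rfl⟩ : ∃ b v, w' = b :: v :=
      List.exists_cons_of_ne_nil (by rintro rfl; simp at hl)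
    have hab : a = b := by
      by_contra hab
      have hvx := (contraction_eq_contraction hP hab (wordMap_mem_convexHull w hx)
        (wordMap_mem_convexHull w' hx') hxx').1
      have hvy := (contraction_eq_contraction hP hab (wordMap_mem_convexHull w hy)
        (wordMap_mem_convexHull w' hy') hyy').1
      exact hxy (wordMap_injective P w (hvx.trans hvy.symm))
    subst hab
    rw [ih (Nat.succ.inj hl) (contraction_injective P a hxx') (contraction_injective P a hyy')]

/-! ### Corners and vertices -/

/-- The words of length `m` over the alphabet `Fin d`. -/
def words (d m : ℕ) : Finset (List (Fin d)) :=
  (Finset.univ : Finset (Fin m → Fin d)).map ⟨List.ofFn, List.ofFn_injective⟩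

theorem mem_words {m : ℕ} {w : List (Fin d)} : w ∈ words d m ↔ w.length = m := by
  simp only [words, Finset.mem_map, Finset.mem_univ, true_and, Function.Embedding.coeFn_mk]
  constructor
  · rintro ⟨f, rfl⟩
    exact List.length_ofFn
  · rintro rfl
    exact ⟨w.get, List.ofFn_get w⟩

theorem card_words (d m : ℕ) : (words d m).card = d ^ m := by
  simp [words]

theorem sum_words_succ (m : ℕ) (F : List (Fin d) → ℝ) :
    ∑ w ∈ words d (m + 1), F w = ∑ w ∈ words d m, ∑ a, F (w ++ [a]) := by
  rw [← Finset.sum_product']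
  symm
  refine Finset.sum_bij (fun p _ => p.1 ++ [p.2]) ?_ ?_ ?_ fun _ _ => rfl
  · intro p hp
    simp [mem_words, mem_words.1 (Finset.mem_product.1 hp).1]
  · intro p _ q _ h
    have := List.append_inj' h rfl
    exact Prod.ext this.1 (by simpa using this.2)
  · intro w hw
    have hne : w ≠ [] := List.ne_nil_of_length_eq_add_one (mem_words.1 hw)
    exact ⟨(w.dropLast, w.getLast hne), by simp [mem_words, mem_words.1 hw],
      List.dropLast_append_getLast hne⟩

/-- The corners of the cells of order `m`: the pair `(w, i)` stands for the vertex `f_w (P i)`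
regarded as a corner of the cell `f_w`. A vertex shared by several cells is a corner of each. -/
def corners (d m : ℕ) : Finset (List (Fin d) × Fin d) := words d m ×ˢ Finset.univ

/-- The vertex `f_w (P i)` at the corner `(w, i)`. -/
def cornerPoint (P : Fin d → Ambient d) (c : List (Fin d) × Fin d) : Ambient d :=
  wordMap P c.1 (P c.2)

theorem mem_corners {m : ℕ} {c : List (Fin d) × Fin d} : c ∈ corners d m ↔ c.1.length = m := by
  simp [corners, mem_words]

theorem card_corners (d m : ℕ) : (corners d m).card = d ^ m * d := by
  simp [corners, card_words]

theorem sum_corners (m : ℕ) (G : List (Fin d) × Fin d → ℝ) :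
    ∑ c ∈ corners d m, G c = ∑ w ∈ words d m, ∑ i, G (w, i) :=
  Finset.sum_product ..

theorem mem_vertices {m : ℕ} {X : Ambient d} :
    X ∈ vertices P m ↔ ∃ c ∈ corners d m, cornerPoint P c = X := by
  induction m generalizing X with
  | zero =>
    simp only [vertices, Finset.mem_image, Finset.mem_univ, true_and, mem_corners]
    constructor
    · rintro ⟨i, rfl⟩
      exact ⟨([], i), rfl, rfl⟩
    · rintro ⟨⟨w, i⟩, h, rfl⟩
      obtain rfl := List.length_eq_zero_iff.1 h
      exact ⟨i, rfl⟩
  | succ m ih =>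
    simp only [vertices, Finset.mem_biUnion, Finset.mem_image, Finset.mem_univ, true_and, ih]
    constructor
    · rintro ⟨a, _, ⟨⟨w, i⟩, h, rfl⟩, rfl⟩
      exact ⟨(a :: w, i), by simpa [mem_corners] using h, rfl⟩
    · rintro ⟨⟨w, i⟩, h, rfl⟩
      obtain ⟨a, w, rfl⟩ := List.exists_cons_of_length_eq_add_one (mem_corners.1 h)
      exact ⟨a, _, ⟨(w, i), by simpa [mem_corners] using h, rfl⟩, rfl⟩

theorem cornerPoint_mem_vertices {c : List (Fin d) × Fin d} :
    cornerPoint P c ∈ vertices P c.1.length :=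
  mem_vertices.2 ⟨c, mem_corners.2 rfl, rfl⟩

theorem card_vertices_le (P : Fin d → Ambient d) (m : ℕ) : (vertices P m).card ≤ d ^ m * d := by
  classical
  rw [← card_corners]
  refine (Finset.card_le_card fun X hX => ?_).trans
    (Finset.card_image_le (s := corners d m) (f := cornerPoint P))
  exact Finset.mem_image.2 (mem_vertices.1 hX)

/-- The corner of the cell `f_{wi}` of the next order at the vertex `f_w (P i)` of the corner
`(w, i)`. -/
def refineCorner : (List (Fin d) × Fin d) ↪ (List (Fin d) × Fin d) where
  toFun c := (c.1 ++ [c.2], c.2)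
  inj' c c' h := by
    obtain ⟨h₁, h₂⟩ := Prod.ext_iff.1 h
    exact Prod.ext (List.append_inj' h₁ rfl).1 h₂

theorem refineCorner_apply (c : List (Fin d) × Fin d) : refineCorner c = (c.1 ++ [c.2], c.2) :=
  rfl

theorem cornerPoint_refineCorner (P : Fin d → Ambient d) (c : List (Fin d) × Fin d) :
    cornerPoint P (refineCorner c) = cornerPoint P c := by
  simp [refineCorner_apply, cornerPoint, wordMap_append, wordMap, contraction_self]

theorem vertices_mono (P : Fin d → Ambient d) : Monotone (vertices P) := by
  refine monotone_nat_of_le_succ fun m X hX => ?_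
  obtain ⟨c, hc, rfl⟩ := mem_vertices.1 hX
  refine mem_vertices.2 ⟨refineCorner c, ?_, cornerPoint_refineCorner P c⟩
  simp [mem_corners, refineCorner_apply, mem_corners.1 hc]

theorem interiorVertices_mono (P : Fin d → Ambient d) : Monotone (interiorVertices P) :=
  fun _ _ h => Finset.sdiff_subset_sdiff (vertices_mono P h) (Finset.Subset.refl _)

theorem mem_interiorVertices {m : ℕ} {X : Ambient d} :
    X ∈ interiorVertices P m ↔ X ∈ vertices P m ∧ X ∉ vertices P 0 := by
  classical
  rw [interiorVertices, Finset.mem_sdiff]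

/-- The vertex `f_w (f_a (P b))` of a cell of the next order inside `f_w`: the midpoint of the edge
of `f_w` between the corners `a` and `b`, or the corner itself if `a = b`. -/
def edgePoint (P : Fin d → Ambient d) (w : List (Fin d)) (a b : Fin d) : Ambient d :=
  wordMap P w (contraction P a (P b))

theorem edgePoint_comm (P : Fin d → Ambient d) (w : List (Fin d)) (a b : Fin d) :
    edgePoint P w a b = edgePoint P w b a := by
  rw [edgePoint, contraction_comm, edgePoint]

theorem edgePoint_self (P : Fin d → Ambient d) (w : List (Fin d)) (i : Fin d) :
    edgePoint P w i i = cornerPoint P (w, i) := by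
  rw [edgePoint, contraction_self, cornerPoint]

theorem cornerPoint_concat (P : Fin d → Ambient d) (w : List (Fin d)) (a b : Fin d) :
    cornerPoint P (w ++ [a], b) = edgePoint P w a b :=
  wordMap_append P w [a] (P b)

theorem edgePoint_ne_vertex (hP : AffineIndependent ℝ P) (w : List (Fin d)) {a b : Fin d}
    (hab : a ≠ b) (j : Fin d) : edgePoint P w a b ≠ P j := by
  intro h
  rw [← cornerPoint_concat] at h
  obtain ⟨hw, hb⟩ := eq_replicate_of_wordMap_eq_vertex hP (wordMap_vertex_mem_convexHull [] b) h
  have ha : a = j := List.eq_of_mem_replicate (n := (w ++ [a]).length) (hw ▸ by simp)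
  exact hab (ha.trans (hP.injective hb).symm)

theorem corner_eq_of_cornerPoint_eq_edgePoint (hP : AffineIndependent ℝ P) {u w : List (Fin d)}
    {a b i : Fin d} (hab : a ≠ b) (hl : w.length = u.length + 1)
    (h : cornerPoint P (w, i) = edgePoint P u a b) :
    (w, i) = (u ++ [a], b) ∨ (w, i) = (u ++ [b], a) := by
  have hmem : ∀ j, P j ∈ convexHull ℝ (range P) := wordMap_vertex_mem_convexHull []
  induction u generalizing w with
  | nil =>
    obtain ⟨c, rfl⟩ := List.length_eq_one_iff.1 hl
    have h' : contraction P c (P i) = contraction P a (P b) := h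
    by_cases hca : c = a
    · subst hca
      exact Or.inl (by rw [hP.injective (contraction_injective P c h')]; rfl)
    · obtain ⟨hi, hb⟩ := contraction_eq_contraction hP hca (hmem i) (hmem b) h'
      exact Or.inr (by rw [hP.injective hi, hP.injective hb]; rfl)
  | cons e u ih =>
    obtain ⟨c, w, rfl⟩ := List.exists_cons_of_length_eq_add_one hl
    have h' : contraction P c (cornerPoint P (w, i)) = contraction P e (edgePoint P u a b) := h
    have hce : c = e := by
      by_contra hce
      exact edgePoint_ne_vertex hP u hab c (contraction_eq_contraction hP hce
        (wordMap_vertex_mem_convexHull w i)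
        (wordMap_mem_convexHull u (contraction_mem_convexHull a (hmem b))) h').2
    subst hce
    simpa using ih (by simpa using hl) (contraction_injective P c h')

theorem edgePoint_notMem_vertices (hP : AffineIndependent ℝ P) {w : List (Fin d)} {a b : Fin d}
    (hab : a ≠ b) : edgePoint P w a b ∉ vertices P w.length := by
  intro h
  obtain ⟨c, hc, h⟩ := mem_vertices.1 h
  rw [← cornerPoint_refineCorner] at h
  have hlast := corner_eq_of_cornerPoint_eq_edgePoint hP hab (by simp [mem_corners.1 hc]) h
  simp only [Prod.mk.injEq, List.append_singleton_inj] at hlast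
  rcases hlast with ⟨⟨-, ha⟩, hb⟩ | ⟨⟨-, hb⟩, ha⟩ <;> exact hab (ha.symm.trans hb)

theorem edgePoint_mem_vertices (P : Fin d → Ambient d) (w : List (Fin d)) (a b : Fin d) :
    edgePoint P w a b ∈ vertices P (w.length + 1) := by
  rw [← cornerPoint_concat]
  exact mem_vertices.2 ⟨_, by simp [mem_corners], rfl⟩

theorem edgePoint_mem_interiorVertices (hP : AffineIndependent ℝ P) (w : List (Fin d))
    {a b : Fin d} (hab : a ≠ b) : edgePoint P w a b ∈ interiorVertices P (w.length + 1) :=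
  mem_interiorVertices.2 ⟨edgePoint_mem_vertices P w a b,
    fun h => edgePoint_notMem_vertices hP hab (vertices_mono P (Nat.zero_le _) h)⟩

open Classical in
/-- The corners of order `m` at the vertex `X`, one for each cell of order `m` through `X`. -/
def fiber (P : Fin d → Ambient d) (m : ℕ) (X : Ambient d) : Finset (List (Fin d) × Fin d) :=
  (corners d m).filter fun c => cornerPoint P c = X

theorem mem_fiber {m : ℕ} {X : Ambient d} {c : List (Fin d) × Fin d} :
    c ∈ fiber P m X ↔ c.1.length = m ∧ cornerPoint P c = X := by
  simp [fiber, mem_corners]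

theorem sum_vertices_fiber (P : Fin d → Ambient d) (m : ℕ) (G : List (Fin d) × Fin d → ℝ) :
    ∑ X ∈ vertices P m, ∑ c ∈ fiber P m X, G c = ∑ c ∈ corners d m, G c := by
  classical
  rw [← Finset.sum_fiberwise_of_maps_to (s := corners d m) (t := vertices P m)
    (g := cornerPoint P) fun c hc => mem_vertices.2 ⟨c, hc, rfl⟩]
  exact Finset.sum_congr rfl fun X _ => Finset.sum_congr (by simp [fiber]) fun _ _ => rfl

theorem fiber_edgePoint (hP : AffineIndependent ℝ P) (w : List (Fin d)) {a b : Fin d}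
    (hab : a ≠ b) :
    fiber P (w.length + 1) (edgePoint P w a b) = {(w ++ [a], b), (w ++ [b], a)} := by
  ext c
  simp only [mem_fiber, Finset.mem_insert, Finset.mem_singleton]
  constructor
  · rintro ⟨hl, h⟩
    exact corner_eq_of_cornerPoint_eq_edgePoint hP hab hl h
  · rintro (rfl | rfl)
    · exact ⟨by simp, cornerPoint_concat P w a b⟩
    · exact ⟨by simp, by rw [cornerPoint_concat, edgePoint_comm]⟩

theorem exists_eq_concat_of_mem_corners_succ {m : ℕ} {c : List (Fin d) × Fin d}
    (hc : c ∈ corners d (m + 1)) : ∃ w a b, w.length = m ∧ c = (w ++ [a], b) := by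
  have hl := mem_corners.1 hc
  have hne : c.1 ≠ [] := List.ne_nil_of_length_eq_add_one hl
  exact ⟨c.1.dropLast, c.1.getLast hne, c.2, by simp [hl],
    Prod.ext (List.dropLast_append_getLast hne).symm rfl⟩

theorem fiber_succ (hP : AffineIndependent ℝ P) {m : ℕ} {X : Ambient d} (hX : X ∈ vertices P m) :
    fiber P (m + 1) X = (fiber P m X).map refineCorner := by
  ext c
  simp only [Finset.mem_map, mem_fiber]
  constructor
  · rintro ⟨hl, rfl⟩
    obtain ⟨w, a, b, rfl, rfl⟩ := exists_eq_concat_of_mem_corners_succ (mem_corners.2 hl)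
    rw [cornerPoint_concat] at hX ⊢
    obtain rfl : a = b := not_imp_comm.1 (edgePoint_notMem_vertices hP) (not_not_intro hX)
    exact ⟨(w, a), ⟨rfl, (edgePoint_self P w a).symm⟩, rfl⟩
  · rintro ⟨c, ⟨rfl, rfl⟩, rfl⟩
    exact ⟨by simp [refineCorner_apply], cornerPoint_refineCorner P c⟩

theorem card_fiber (hP : AffineIndependent ℝ P) {m : ℕ} {X : Ambient d}
    (hX : X ∈ interiorVertices P m) : (fiber P m X).card = 2 := by
  rw [mem_interiorVertices] at hX
  obtain ⟨hX, hX₀⟩ := hX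
  induction m with
  | zero => exact absurd hX hX₀
  | succ m ih =>
    by_cases hXm : X ∈ vertices P m
    · rw [fiber_succ hP hXm, Finset.card_map, ih hXm]
    obtain ⟨c, hc, rfl⟩ := mem_vertices.1 hX
    obtain ⟨w, a, b, rfl, rfl⟩ := exists_eq_concat_of_mem_corners_succ hc
    rw [cornerPoint_concat] at hXm ⊢
    have hab : a ≠ b := by
      rintro rfl
      exact hXm (edgePoint_self P w a ▸ cornerPoint_mem_vertices)
    rw [fiber_edgePoint hP w hab, Finset.card_pair (by simp [hab])]

/-! ### Harmonic splines and their integrals -/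

/-- The Laplacian at a corner of a cell, for the complete graph on the vertices of that cell. -/
def cellLaplacian (P : Fin d → Ambient d) (v : Ambient d → ℝ) (c : List (Fin d) × Fin d) : ℝ :=
  ∑ j, (v (cornerPoint P (c.1, j)) - v (cornerPoint P c))

theorem cornerPoint_injective (hP : AffineIndependent ℝ P) (w : List (Fin d)) :
    Function.Injective fun j => cornerPoint P (w, j) :=
  (wordMap_injective P w).comp hP.injective

open Classical in
theorem filter_adj_eq_biUnion (hP : AffineIndependent ℝ P) (m : ℕ) (X : Ambient d) :
    (vertices P m).filter (Adj P m X) = (fiber P m X).biUnion fun c =>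
      (Finset.univ.erase c.2).image fun j => cornerPoint P (c.1, j) := by
  ext Y
  simp only [Finset.mem_filter, Finset.mem_biUnion, Finset.mem_image, Finset.mem_erase,
    Finset.mem_univ, and_true, mem_fiber]
  constructor
  · rintro ⟨-, hne, w, rfl, i, j, rfl, rfl⟩
    exact ⟨(w, i), ⟨rfl, rfl⟩, j, by rintro rfl; exact hne rfl, rfl⟩
  · rintro ⟨⟨w, i⟩, ⟨rfl, rfl⟩, j, hji, rfl⟩
    exact ⟨cornerPoint_mem_vertices, fun h => hji (cornerPoint_injective hP w h.symm),
      w, rfl, i, j, rfl, rfl⟩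

open Classical in
theorem pairwiseDisjoint_fiber_neighbors (hP : AffineIndependent ℝ P) (m : ℕ) (X : Ambient d) :
    (fiber P m X : Set (List (Fin d) × Fin d)).PairwiseDisjoint fun c =>
      (Finset.univ.erase c.2).image fun j => cornerPoint P (c.1, j) := by
  rintro ⟨w, i⟩ hc ⟨w', i'⟩ hc' hne
  obtain ⟨hl, hX⟩ := mem_fiber.1 hc
  obtain ⟨hl', hX'⟩ := mem_fiber.1 hc'
  have hmem : ∀ j, P j ∈ convexHull ℝ (range P) := wordMap_vertex_mem_convexHull []
  refine Finset.disjoint_left.2 fun Y hY hY' => hne ?_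
  simp only [Finset.mem_image, Finset.mem_erase, Finset.mem_univ, and_true] at hY hY'
  obtain ⟨j, hji, rfl⟩ := hY
  obtain ⟨j', -, hj'⟩ := hY'
  obtain rfl : w = w' := eq_of_wordMap_eq_of_ne hP (hl.trans hl'.symm) (hmem i) (hmem j) (hmem i')
    (hmem j') (fun h => hji (hP.injective h).symm) (hX.trans hX'.symm) hj'.symm
  rw [cornerPoint_injective hP w (hX.trans hX'.symm)]

theorem graphLaplacian_eq (hP : AffineIndependent ℝ P) (m : ℕ) (v : Ambient d → ℝ)
    (X : Ambient d) : graphLaplacian P m v X = ∑ c ∈ fiber P m X, cellLaplacian P v c := by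
  classical
  rw [graphLaplacian, filter_adj_eq_biUnion hP,
    Finset.sum_biUnion (pairwiseDisjoint_fiber_neighbors hP m X)]
  refine Finset.sum_congr rfl fun c hc => ?_
  rw [Finset.sum_image (cornerPoint_injective hP c.1).injOn, cellLaplacian,
    ← Finset.add_sum_erase _ _ (Finset.mem_univ c.2), (mem_fiber.1 hc).2.symm]
  simp

theorem graphLaplacian_edgePoint (hP : AffineIndependent ℝ P) (w : List (Fin d)) {a b : Fin d}
    (hab : a ≠ b) (v : Ambient d → ℝ) :
    graphLaplacian P (w.length + 1) v (edgePoint P w a b) =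
      ∑ c, (v (edgePoint P w a c) - v (edgePoint P w a b)) +
      ∑ c, (v (edgePoint P w b c) - v (edgePoint P w a b)) := by
  rw [graphLaplacian_eq hP, fiber_edgePoint hP w hab, Finset.sum_pair (by simp [hab])]
  simp only [cellLaplacian, cornerPoint_concat, edgePoint_comm P w b a]

/-- Summing the harmonicity defects over all pairs `(a, b)`, only the diagonal ones survive. -/
theorem sum_sum_eq_of_harmonic {ι : Type*} [Fintype ι] (y : ι → ι → ℝ)
    (hy : ∀ a b, a ≠ b → ∑ c, (y a c - y a b) + ∑ c, (y b c - y a b) = 0) :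
    ∑ a, ∑ b, y a b = Fintype.card ι * ∑ a, y a a := by
  classical
  have hdefect : ∀ a b, ∑ c, (y a c - y a b) + ∑ c, (y b c - y a b) =
      if a = b then 2 * ∑ c, (y a c - y a a) else 0 := by
    intro a b
    split_ifs with hab
    · rw [hab, two_mul]
    · exact hy a b hab
  have hsum : ∑ a, ∑ b, (∑ c, (y a c - y a b) + ∑ c, (y b c - y a b)) =
      ∑ a, 2 * ∑ c, (y a c - y a a) := by
    simp only [hdefect, Finset.sum_ite_eq, Finset.mem_univ, if_true]
  simp only [Finset.sum_sub_distrib, Finset.sum_add_distrib, Finset.sum_const, Finset.card_univ,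
    nsmul_eq_mul, ← Finset.mul_sum] at hsum
  linarith

theorem sum_corners_succ_of_harmonic (hP : AffineIndependent ℝ P) {n : ℕ} {ψ : Ambient d → ℝ}
    (hψ : ∀ Y ∈ vertices P (n + 1), Y ∉ vertices P n → graphLaplacian P (n + 1) ψ Y = 0) :
    ∑ c ∈ corners d (n + 1), ψ (cornerPoint P c) =
      d * ∑ c ∈ corners d n, ψ (cornerPoint P c) := by
  rw [sum_corners, sum_corners, sum_words_succ, Finset.mul_sum]
  refine Finset.sum_congr rfl fun w hw => ?_
  obtain rfl := mem_words.1 hw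
  simp only [cornerPoint_concat]
  simp only [← edgePoint_self]
  rw [sum_sum_eq_of_harmonic, Fintype.card_fin]
  intro a b hab
  rw [← graphLaplacian_edgePoint hP w hab]
  exact hψ _ (edgePoint_mem_vertices P w a b) (edgePoint_notMem_vertices hP hab)

theorem sum_corners_harmonicSpline (hP : AffineIndependent ℝ P) {m : ℕ} {X : Ambient d}
    (hX : X ∈ interiorVertices P m) {ψ : Ambient d → ℝ} (hψ : IsHarmonicSpline P m X ψ) (k : ℕ) :
    ∑ c ∈ corners d (m + k), ψ (cornerPoint P c) = 2 * d ^ k := by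
  classical
  induction k with
  | zero =>
    have hvalue : ∀ c ∈ corners d m,
        ψ (cornerPoint P c) = if cornerPoint P c = X then 1 else 0 := by
      intro c hc
      split_ifs with h
      · rw [h, hψ.eq_one]
      · exact hψ.eq_zero _ (mem_vertices.2 ⟨c, hc, rfl⟩) h
    have hcard : ((corners d m).filter fun c => cornerPoint P c = X).card = 2 := by
      rw [← card_fiber hP hX, fiber]
    rw [add_zero, Finset.sum_congr rfl hvalue, Finset.sum_boole, hcard]
    simp
  | succ k ih =>
    rw [← add_assoc, sum_corners_succ_of_harmonic hP, ih]
    · ring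
    · exact fun Y hY hYk => hψ.harmonic _ (by omega) Y hY
        fun h => hYk (vertices_mono P (Nat.le_add_right m k) h)

theorem integral_infinitePi_uniform_prefix {α : Type*} [Fintype α] [Nonempty α]
    [MeasurableSpace α] [MeasurableSingletonClass α] (n : ℕ) (F : (Fin n → α) → ℝ) :
    ∫ ω, F (fun i => ω i) ∂(Measure.infinitePi fun _ : ℕ => (PMF.uniformOfFintype α).toMeasure) =
      ((Fintype.card α : ℝ) ^ n)⁻¹ * ∑ s, F s := by
  have hmap := Measure.map_infinitePi_infinitePi_of_inj
    (P := fun _ : ℕ => (PMF.uniformOfFintype α).toMeasure) (Fin.val_injective (n := n))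
  rw [← integral_map (φ := fun (ω : ℕ → α) (i : Fin n) => ω i)
    (Measurable.aemeasurable (by fun_prop)) (measurable_of_finite F).aestronglyMeasurable, hmap,
    integral_fintype .of_finite, Finset.mul_sum]
  refine Finset.sum_congr rfl fun s _ => ?_
  rw [Measure.real, Measure.infinitePi_singleton_of_fintype, ENNReal.toReal_prod]
  simp [PMF.toMeasure_apply_singleton _ _ (measurableSet_singleton _)]

theorem address_eq_wordMap (P : Fin d → Ambient d) (ω : ℕ → Fin d) (n : ℕ) :
    address P ω = wordMap P (List.ofFn fun i : Fin n => ω i) (address P fun k => ω (n + k)) := by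
  induction n generalizing ω with
  | zero => simp [wordMap]
  | succ n ih =>
    rw [address_eq, ih fun k => ω (k + 1), List.ofFn_succ]
    simp only [wordMap, Function.comp_apply, Fin.val_zero, Fin.val_succ, Nat.add_right_comm n _ 1,
      Nat.add_assoc]

theorem isCompact_simplex (P : Fin d → Ambient d) : IsCompact (simplex P) :=
  isCompact_range (continuous_address P)

theorem contraction_mem_simplex (i : Fin d) {x : Ambient d} (hx : x ∈ simplex P) :
    contraction P i x ∈ simplex P := by
  rw [simplex_eq_iUnion]
  exact mem_iUnion.2 ⟨i, x, hx, rfl⟩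

theorem wordMap_mem_simplex (w : List (Fin d)) {x : Ambient d} (hx : x ∈ simplex P) :
    wordMap P w x ∈ simplex P := by
  induction w with
  | nil => exact hx
  | cons a w ih => exact contraction_mem_simplex a ih

theorem vertex_mem_simplex (P : Fin d → Ambient d) (i : Fin d) : P i ∈ simplex P := by
  refine ⟨fun _ => i, ?_⟩
  have hsum : HasSum (fun n : ℕ => (2⁻¹ : ℝ) ^ (n + 1)) 1 := by
    simpa [pow_succ', div_eq_mul_inv] using hasSum_geometric_two' 1
  rw [address, (hsum.smul_const (P i)).tsum_eq, one_smul]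

theorem vertices_subset_simplex {m : ℕ} {X : Ambient d} (hX : X ∈ vertices P m) :
    X ∈ simplex P := by
  obtain ⟨c, -, rfl⟩ := mem_vertices.1 hX
  exact wordMap_mem_simplex c.1 (vertex_mem_simplex P c.2)

theorem dist_wordMap_le (w : List (Fin d)) {x y : Ambient d} (hx : x ∈ simplex P)
    (hy : y ∈ simplex P) :
    dist (wordMap P w x) (wordMap P w y) ≤ (2⁻¹ : ℝ) ^ w.length * Metric.diam (simplex P) := by
  rw [dist_wordMap]
  gcongr
  exact Metric.dist_le_diam_of_mem (isCompact_simplex P).isBounded hx hy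

theorem tendsto_wordMap_address (P : Fin d → Ambient d) (ω : ℕ → Fin d) {x : Ambient d}
    (hx : x ∈ simplex P) :
    Tendsto (fun n : ℕ => wordMap P (List.ofFn fun k : Fin n => ω k) x) atTop
      (𝓝 (address P ω)) := by
  rw [tendsto_iff_dist_tendsto_zero]
  have hgeom : Tendsto (fun n : ℕ => (2⁻¹ : ℝ) ^ n * Metric.diam (simplex P)) atTop (𝓝 0) := by
    simpa using (tendsto_pow_atTop_nhds_zero_of_lt_one (r := (2⁻¹ : ℝ)) (by norm_num)
      (by norm_num)).mul_const (Metric.diam (simplex P))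
  refine squeeze_zero (fun _ => dist_nonneg) (fun n => ?_) hgeom
  rw [address_eq_wordMap P ω n]
  simpa using dist_wordMap_le (List.ofFn fun k : Fin n => ω k) hx (mem_range_self _)

theorem integral_selfSimilarMeasure [NeZero d] {ψ : Ambient d → ℝ}
    (hψ : ContinuousOn ψ (simplex P)) :
    ∫ y, ψ y ∂(selfSimilarMeasure P) = ∫ ω, ψ (address P ω)
      ∂(Measure.infinitePi fun _ : ℕ => (PMF.uniformOfFintype (Fin d)).toMeasure) := by
  have hmeas : Measurable (address P) := (continuous_address P).measurable
  have hK : MeasurableSet (simplex P) := (isCompact_simplex P).measurableSet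
  have hsupp : (selfSimilarMeasure P).restrict (simplex P) = selfSimilarMeasure P :=
    Measure.restrict_eq_self_of_ae_mem ((ae_map_iff hmeas.aemeasurable hK).2
      (Eventually.of_forall fun ω => mem_range_self ω))
  have hsm : AEStronglyMeasurable ψ (selfSimilarMeasure P) :=
    hsupp ▸ hψ.aestronglyMeasurable hK
  exact integral_map hmeas.aemeasurable hsm

/-- The average of `ψ` over the corners of the cell `f_w`. -/
def cellAverage (P : Fin d → Ambient d) (ψ : Ambient d → ℝ) (w : List (Fin d)) : ℝ :=
  (d : ℝ)⁻¹ * ∑ i, ψ (cornerPoint P (w, i))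

theorem tendsto_cellAverage [NeZero d] {ψ : Ambient d → ℝ} (hψ : ContinuousOn ψ (simplex P))
    (ω : ℕ → Fin d) :
    Tendsto (fun n : ℕ => cellAverage P ψ (List.ofFn fun k : Fin n => ω k)) atTop
      (𝓝 (ψ (address P ω))) := by
  have hcorner : ∀ i, Tendsto (fun n : ℕ => ψ (cornerPoint P (List.ofFn fun k : Fin n => ω k, i)))
      atTop (𝓝 (ψ (address P ω))) := fun i =>
    (hψ _ (mem_range_self ω)).tendsto.comp (tendsto_nhdsWithin_iff.2
      ⟨tendsto_wordMap_address P ω (vertex_mem_simplex P i),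
        Eventually.of_forall fun n => wordMap_mem_simplex _ (vertex_mem_simplex P i)⟩)
  simpa [cellAverage, NeZero.ne d] using
    (tendsto_finsetSum Finset.univ fun i _ => hcorner i).const_mul (d : ℝ)⁻¹

theorem tendsto_average_corners [NeZero d] {ψ : Ambient d → ℝ}
    (hψ : ContinuousOn ψ (simplex P)) :
    Tendsto (fun n : ℕ => ((d : ℝ) ^ n)⁻¹ * ((d : ℝ)⁻¹ * ∑ c ∈ corners d n, ψ (cornerPoint P c)))
      atTop (𝓝 (∫ y, ψ y ∂(selfSimilarMeasure P))) := by
  obtain ⟨B, hB⟩ := (isCompact_simplex P).exists_bound_of_continuousOn hψ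
  have hbound : ∀ w, ‖cellAverage P ψ w‖ ≤ B := fun w => by
    have hd : (0 : ℝ) < d := Nat.cast_pos.2 (NeZero.pos d)
    rw [cellAverage, norm_mul, norm_inv, Real.norm_natCast, inv_mul_le_iff₀ hd]
    refine (norm_sum_le_of_le _ fun i _ =>
      hB _ (wordMap_mem_simplex w (vertex_mem_simplex P i))).trans_eq ?_
    simp
  have haverage : ∀ n : ℕ, ∫ ω, cellAverage P ψ (List.ofFn fun k : Fin n => ω k)
        ∂(Measure.infinitePi fun _ : ℕ => (PMF.uniformOfFintype (Fin d)).toMeasure) =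
      ((d : ℝ) ^ n)⁻¹ * ((d : ℝ)⁻¹ * ∑ c ∈ corners d n, ψ (cornerPoint P c)) := fun n => by
    rw [integral_infinitePi_uniform_prefix n fun s => cellAverage P ψ (List.ofFn s),
      Fintype.card_fin, sum_corners, words, Finset.sum_map, Finset.mul_sum _ _ (d : ℝ)⁻¹]
    rfl
  rw [integral_selfSimilarMeasure hψ]
  simp only [← haverage]
  refine tendsto_integral_of_dominated_convergence (fun _ => B) (fun n => ?_) (integrable_const _)
    (fun n => Eventually.of_forall fun ω => hbound _)
    (Eventually.of_forall fun ω => tendsto_cellAverage hψ ω)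
  have hcont : Continuous fun (ω : ℕ → Fin d) (k : Fin n) => ω k := by fun_prop
  exact ((continuous_of_discreteTopology (f := fun s : Fin n → Fin d =>
    cellAverage P ψ (List.ofFn s))).comp hcont).aestronglyMeasurable

theorem integral_harmonicSpline [NeZero d] (hP : AffineIndependent ℝ P) {m : ℕ} {X : Ambient d}
    (hX : X ∈ interiorVertices P m) {ψ : Ambient d → ℝ} (hψ : IsHarmonicSpline P m X ψ) :
    ∫ y, ψ y ∂(selfSimilarMeasure P) = 2 / (d : ℝ) ^ (m + 1) := by
  refine tendsto_nhds_unique (tendsto_average_corners hψ.continuousOn)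
    (tendsto_const_nhds.congr' ?_)
  filter_upwards [eventually_ge_atTop m] with n hn
  obtain ⟨k, rfl⟩ := Nat.exists_eq_add_of_le hn
  have hd : (d : ℝ) ≠ 0 := NeZero.ne _
  rw [sum_corners_harmonicSpline hP hX hψ]
  field_simp
  ring

theorem laplacianQuotient_eq_normalizedLaplacian [NeZero d] (hP : AffineIndependent ℝ P) {m : ℕ}
    {X : Ambient d} (hX : X ∈ interiorVertices P m) {ψ : Ambient d → ℝ}
    (hψ : IsHarmonicSpline P m X ψ) (v : Ambient d → ℝ) :
    (energyRatio d ^ m)⁻¹ * (∫ y, ψ y ∂(selfSimilarMeasure P))⁻¹ * graphLaplacian P m v X =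
      normalizedLaplacian P m v X := by
  have hd : (d : ℝ) ≠ 0 := NeZero.ne _
  rw [integral_harmonicSpline hP hX hψ, normalizedLaplacian, energyRatio, div_pow]
  field_simp
  ring

/-! ### Uniform convergence -/

theorem exists_tendsto_extension_of_strictMono {E : Type*} [TopologicalSpace E] {A : ℕ → Set E}
    (hA : Monotone A) {n₀ : ℕ} (hne : (A n₀).Nonempty) {φ : ℕ → ℕ} (hφ : StrictMono φ)
    {Z : ℕ → E} (hZ : ∀ k, Z k ∈ A (φ k)) {x : E} (hlim : Tendsto Z atTop (𝓝 x)) :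
    ∃ X : ℕ → E, (∀ m, n₀ ≤ m → X m ∈ A m) ∧ (∀ k, X (φ k) = Z k) ∧ Tendsto X atTop (𝓝 x) := by
  obtain ⟨x₀, hx₀⟩ := hne
  let κ : ℕ → ℕ := fun m => Nat.findGreatest (fun k => φ k ≤ m) m
  have le_κ : ∀ {k m}, φ k ≤ m → k ≤ κ m := fun h => Nat.le_findGreatest (hφ.le_apply.trans h) h
  have φ_κ_le : ∀ {m}, φ 0 ≤ m → φ (κ m) ≤ m := fun {m} h =>
    Nat.findGreatest_spec (P := fun k => φ k ≤ m) (Nat.zero_le m) h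
  have φ_zero_le : ∀ k, φ 0 ≤ φ k := fun k => hφ.monotone k.zero_le
  refine ⟨fun m => if φ 0 ≤ m then Z (κ m) else x₀, fun m hm => ?_, fun k => ?_, ?_⟩
  · dsimp only
    split_ifs with h
    · exact hA (φ_κ_le h) (hZ _)
    · exact hA hm hx₀
  · have hκφ : κ (φ k) = k :=
      le_antisymm (hφ.le_iff_le.1 (φ_κ_le (φ_zero_le k))) (le_κ le_rfl)
    simp only [φ_zero_le, if_true, hκφ]
  · have hκ : Tendsto κ atTop atTop :=
      tendsto_atTop.2 fun k => (eventually_ge_atTop (φ k)).mono fun _ => le_κ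
    refine (hlim.comp hκ).congr' ?_
    filter_upwards [eventually_ge_atTop (φ 0)] with m hm
    simp only [hm, if_true, Function.comp_apply]

/-- Convergence along all convergent sequences of points of an increasing sequence of subsets of a
compact set is uniform: otherwise the bad points would have a convergent subsequence, and filling
its gaps with earlier terms, which is possible as the subsets increase, gives a full sequence. -/
theorem eventually_forall_abs_sub_lt_of_tendsto {E : Type*} [PseudoMetricSpace E] {K : Set E}
    (hK : IsCompact K) {f : E → ℝ} (hf : ContinuousOn f K) {A : ℕ → Set E} (hA : Monotone A)
    (hAK : ∀ n, A n ⊆ K) {n₀ : ℕ} {F : ℕ → E → ℝ}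
    (hF : ∀ x ∈ K, ∀ X : ℕ → E, (∀ m, n₀ ≤ m → X m ∈ A m) → Tendsto X atTop (𝓝 x) →
      Tendsto (fun m => F m (X m)) atTop (𝓝 (f x)))
    (hne : (⋃ n, A n).Nonempty → (A n₀).Nonempty) {ε : ℝ} (hε : 0 < ε) :
    ∀ᶠ n in atTop, ∀ X ∈ A n, |F n X - f X| < ε := by
  by_contra hcon
  have hfreq : ∃ᶠ n in atTop, ∃ X ∈ A n, ε ≤ |F n X - f X| := by
    simpa only [not_eventually, not_forall, not_lt, exists_prop] using hcon
  obtain ⟨φ, hφ, hbad⟩ := extraction_of_frequently_atTop hfreq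
  choose Y hYA hY using hbad
  obtain ⟨x, hx, θ, hθ, hlim⟩ := hK.tendsto_subseq fun n => hAK _ (hYA n)
  obtain ⟨X, hXA, hXφ, hX⟩ := exists_tendsto_extension_of_strictMono hA
    (hne ⟨_, mem_iUnion.2 ⟨_, hYA 0⟩⟩) (hφ.comp hθ) (fun k => hYA (θ k)) hlim
  have hFlim := (hF x hx X hXA hX).comp (hφ.comp hθ).tendsto_atTop
  have hflim : Tendsto (fun k => f (Y (θ k))) atTop (𝓝 (f x)) :=
    (hf x hx).tendsto.comp (tendsto_nhdsWithin_iff.2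
      ⟨hlim, Eventually.of_forall fun k => hAK _ (hYA (θ k))⟩)
  have hdiff := (hFlim.sub hflim).abs
  rw [sub_self, abs_zero] at hdiff
  obtain ⟨k, hk⟩ := (hdiff.eventually_lt_const hε).exists
  rw [Function.comp_apply, hXφ] at hk
  exact (hY (θ k)).not_gt hk

theorem exists_ne_of_mem_interiorVertices (hP : AffineIndependent ℝ P) {m : ℕ} {X : Ambient d}
    (hX : X ∈ interiorVertices P m) : ∃ a b : Fin d, a ≠ b := by
  by_contra! hsub
  have hd : d ≤ 1 := Fin.subsingleton_iff_le_one.1 ⟨hsub⟩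
  have hcard : 2 ≤ d ^ m * d := by
    classical
    rw [← card_fiber hP hX, ← card_corners]
    exact Finset.card_filter_le _ _
  have hpow : d ^ m * d ≤ 1 := mul_le_one' (pow_le_one' hd m) hd
  omega

theorem HasLaplacian.tendsto_normalizedLaplacian [NeZero d] {v f : Ambient d → ℝ}
    (hv : HasLaplacian P v f) (hP : AffineIndependent ℝ P) {x : Ambient d} (hx : x ∈ simplex P)
    {X : ℕ → Ambient d} (hX : ∀ m, 1 ≤ m → X m ∈ interiorVertices P m)
    (hXx : Tendsto X atTop (𝓝 x)) :
    Tendsto (fun m => normalizedLaplacian P m v (X m)) atTop (𝓝 (f x)) := by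
  obtain ⟨ψ, hψ, hlim⟩ := hv.tendsto x hx X hX hXx
  refine hlim.congr' ?_
  filter_upwards [eventually_ge_atTop 1] with m hm
  exact laplacianQuotient_eq_normalizedLaplacian hP (hX m hm) (hψ m hm) v

theorem HasLaplacian.eventually_abs_sub_lt [NeZero d] {v f : Ambient d → ℝ}
    (hv : HasLaplacian P v f) (hP : AffineIndependent ℝ P) {ε : ℝ} (hε : 0 < ε) :
    ∀ᶠ n in atTop, ∀ X ∈ interiorVertices P n, |normalizedLaplacian P n v X - f X| < ε := by
  refine eventually_forall_abs_sub_lt_of_tendsto (A := fun n => interiorVertices P n)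
    (F := fun n => normalizedLaplacian P n v) (isCompact_simplex P) hv.continuousOn_laplacian
    (fun _ _ h => interiorVertices_mono P h) (fun n X hX => ?_)
    (fun x hx X hX => hv.tendsto_normalizedLaplacian hP hx hX) ?_ hε
  · exact vertices_subset_simplex (mem_interiorVertices.1 hX).1
  · rintro ⟨X, hX⟩
    obtain ⟨n, hX⟩ := mem_iUnion.1 hX
    obtain ⟨a, b, hab⟩ := exists_ne_of_mem_interiorVertices hP hX
    exact ⟨_, edgePoint_mem_interiorVertices hP [] hab⟩

/-! ### Averaging over the next order -/

/-- The weight of the edge `p` of a cell in the average at the corner `i`: it is `(d + 2) / 2` times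
the value at the midpoint of `p` of the harmonic spline at `i`. The factor `1 / 2` makes up for
counting each edge twice, as an ordered pair. -/
def edgeWeight {ι : Type*} [DecidableEq ι] (i : ι) (p : ι × ι) : ℝ :=
  (1 + (if p.1 = i then 1 else 0) + if p.2 = i then 1 else 0) / 2

theorem edgeWeight_nonneg {ι : Type*} [DecidableEq ι] (i : ι) (p : ι × ι) : 0 ≤ edgeWeight i p := by
  unfold edgeWeight
  positivity

theorem sum_offDiag_univ {ι : Type*} [Fintype ι] (G : ι × ι → ℝ) :
    ∑ p ∈ Finset.univ.offDiag, G p = ∑ a, ∑ b, G (a, b) - ∑ a, G (a, a) := by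
  classical
  rw [eq_sub_iff_add_eq', ← Finset.sum_diag, ← Finset.sum_union (Finset.disjoint_diag_offDiag _),
    Finset.diag_union_offDiag, Finset.sum_product]

theorem sum_edgeWeight_mul {ι : Type*} [Fintype ι] [DecidableEq ι] (i : ι) {D : ι × ι → ℝ}
    (hD : ∀ a b, D (a, b) = D (b, a)) :
    ∑ p ∈ Finset.univ.offDiag, edgeWeight i p * D p =
      (∑ a, ∑ b, D (a, b) - ∑ a, D (a, a)) / 2 + ∑ b, D (i, b) - D (i, i) := by
  rw [sum_offDiag_univ]
  simp only [edgeWeight, add_mul, add_div, Finset.sum_add_distrib, ite_mul, ite_div, zero_div,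
    zero_mul, Finset.sum_ite_irrel, Finset.sum_const_zero, Finset.sum_ite_eq', Finset.mem_univ,
    if_true, ← Finset.mul_sum, hD _ i]
  ring

theorem sum_edgeWeight {ι : Type*} [Fintype ι] [DecidableEq ι] (i : ι) :
    ∑ p ∈ Finset.univ.offDiag, edgeWeight i p =
      ((Fintype.card ι : ℝ) - 1) * (Fintype.card ι + 2) / 2 := by
  have h := sum_edgeWeight_mul i (D := fun _ => 1) fun _ _ => rfl
  simp only [mul_one, Finset.sum_const, Finset.card_univ, nsmul_eq_mul] at h
  rw [h]
  ring

theorem card_mul_sum_sub_eq {ι : Type*} [Fintype ι] [DecidableEq ι] {y : ι → ι → ℝ}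
    (hy : ∀ a b, y a b = y b a) (i : ι) :
    Fintype.card ι * ∑ j, (y j j - y i i) = (Fintype.card ι + 2) * ∑ c, (y i c - y i i) +
      ∑ p ∈ Finset.univ.offDiag, edgeWeight i p *
        (∑ c, (y p.1 c - y p.1 p.2) + ∑ c, (y p.2 c - y p.1 p.2)) := by
  rw [sum_edgeWeight_mul i fun a b => by simp only [hy a b, add_comm]]
  simp only [Finset.sum_sub_distrib, Finset.sum_add_distrib, Finset.sum_const,
    Finset.card_univ, nsmul_eq_mul, ← Finset.mul_sum]
  ring

theorem card_mul_cellLaplacian (hP : AffineIndependent ℝ P) (v : Ambient d → ℝ)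
    (c : List (Fin d) × Fin d) :
    d * cellLaplacian P v c = (d + 2) * cellLaplacian P v (refineCorner c) +
      ∑ p ∈ Finset.univ.offDiag, edgeWeight c.2 p *
        graphLaplacian P (c.1.length + 1) v (edgePoint P c.1 p.1 p.2) := by
  obtain ⟨w, i⟩ := c
  have h := card_mul_sum_sub_eq (y := fun a b => v (edgePoint P w a b))
    (fun a b => by rw [edgePoint_comm]) i
  rw [Fintype.card_fin] at h
  simp only [edgePoint_self] at h
  simp only [cellLaplacian, refineCorner_apply, cornerPoint_concat, edgePoint_self, h]
  congr 1
  refine Finset.sum_congr rfl fun p hp => ?_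
  rw [graphLaplacian_edgePoint hP w (Finset.mem_offDiag.1 hp).2.2]

theorem card_mul_normalizedLaplacian (hP : AffineIndependent ℝ P) {m : ℕ} {X : Ambient d}
    (hX : X ∈ vertices P m) (v : Ambient d → ℝ) :
    d * normalizedLaplacian P m v X = normalizedLaplacian P (m + 1) v X +
      ((d : ℝ) + 2)⁻¹ * ∑ c ∈ fiber P m X, ∑ p ∈ Finset.univ.offDiag, edgeWeight c.2 p *
        normalizedLaplacian P (m + 1) v (edgePoint P c.1 p.1 p.2) := by
  have hcell : d * graphLaplacian P m v X = (d + 2) * graphLaplacian P (m + 1) v X +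
      ∑ c ∈ fiber P m X, ∑ p ∈ Finset.univ.offDiag, edgeWeight c.2 p *
        graphLaplacian P (m + 1) v (edgePoint P c.1 p.1 p.2) := by
    rw [graphLaplacian_eq hP, graphLaplacian_eq hP, fiber_succ hP hX, Finset.sum_map,
      Finset.mul_sum, Finset.mul_sum, ← Finset.sum_add_distrib]
    refine Finset.sum_congr rfl fun c hc => ?_
    rw [card_mul_cellLaplacian hP, (mem_fiber.1 hc).1]
  have hd : (d : ℝ) + 2 ≠ 0 := by positivity
  simp only [normalizedLaplacian, mul_left_comm (edgeWeight _ _), ← Finset.mul_sum]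
  rw [mul_left_comm, hcell, pow_succ]
  field_simp

theorem sum_fiber_edgeWeight (hP : AffineIndependent ℝ P) {m : ℕ} {X : Ambient d}
    (hX : X ∈ interiorVertices P m) :
    ∑ c ∈ fiber P m X, ∑ p ∈ Finset.univ.offDiag, edgeWeight c.2 p = ((d : ℝ) - 1) * (d + 2) := by
  simp only [sum_edgeWeight, Finset.sum_const, card_fiber hP hX, Fintype.card_fin, nsmul_eq_mul]
  push_cast
  ring

theorem card_mul_normalizedLaplacian_sub (hP : AffineIndependent ℝ P) {m : ℕ} {X : Ambient d}
    (hX : X ∈ interiorVertices P m) (v : Ambient d → ℝ) (κ : ℝ) :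
    d * (normalizedLaplacian P m v X - κ) = (normalizedLaplacian P (m + 1) v X - κ) +
      ((d : ℝ) + 2)⁻¹ * ∑ c ∈ fiber P m X, ∑ p ∈ Finset.univ.offDiag, edgeWeight c.2 p *
        (normalizedLaplacian P (m + 1) v (edgePoint P c.1 p.1 p.2) - κ) := by
  simp only [mul_sub, Finset.sum_sub_distrib, ← Finset.sum_mul]
  rw [sum_fiber_edgeWeight hP hX, card_mul_normalizedLaplacian hP (mem_interiorVertices.1 hX).1]
  field_simp
  ring

theorem abs_sum_fiber_edgeWeight_mul_le (hP : AffineIndependent ℝ P) {m : ℕ} {X : Ambient d}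
    (hX : X ∈ interiorVertices P m) {D : List (Fin d) × Fin d → Fin d × Fin d → ℝ} {ρ : ℝ}
    (hD : ∀ c ∈ fiber P m X, ∀ p ∈ Finset.univ.offDiag, |D c p| ≤ ρ) :
    |∑ c ∈ fiber P m X, ∑ p ∈ Finset.univ.offDiag, edgeWeight c.2 p * D c p| ≤
      ((d : ℝ) - 1) * (d + 2) * ρ := by
  simp only [← sum_fiber_edgeWeight hP hX, Finset.sum_mul]
  refine (Finset.abs_sum_le_sum_abs _ _).trans (Finset.sum_le_sum fun c hc =>
    (Finset.abs_sum_le_sum_abs _ _).trans (Finset.sum_le_sum fun p hp => ?_))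
  rw [abs_mul, abs_of_nonneg (edgeWeight_nonneg _ _)]
  exact mul_le_mul_of_nonneg_left (hD c hc p hp) (edgeWeight_nonneg _ _)

theorem abs_normalizedLaplacian_sub_le_of_succ [NeZero d] (hP : AffineIndependent ℝ P) {m : ℕ}
    {X : Ambient d} (hX : X ∈ interiorVertices P m) (v : Ambient d → ℝ) {κ ρ : ℝ}
    (h : ∀ Y ∈ interiorVertices P (m + 1),
      dist Y X ≤ (2⁻¹ : ℝ) ^ m * Metric.diam (simplex P) →
      |normalizedLaplacian P (m + 1) v Y - κ| ≤ ρ) :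
    |normalizedLaplacian P m v X - κ| ≤ ρ := by
  have hd : 0 < (d : ℝ) := Nat.cast_pos.2 (NeZero.pos d)
  have hX' : |normalizedLaplacian P (m + 1) v X - κ| ≤ ρ :=
    h X (interiorVertices_mono P m.le_succ hX) (by rw [dist_self]; positivity)
  have hedge : ∀ c ∈ fiber P m X, ∀ p ∈ (Finset.univ : Finset (Fin d)).offDiag,
      |normalizedLaplacian P (m + 1) v (edgePoint P c.1 p.1 p.2) - κ| ≤ ρ := by
    rintro ⟨w, i⟩ hc ⟨a, b⟩ hp
    obtain ⟨rfl, rfl⟩ := mem_fiber.1 hc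
    exact h _ (edgePoint_mem_interiorVertices hP w (Finset.mem_offDiag.1 hp).2.2)
      (dist_wordMap_le w (contraction_mem_simplex a (vertex_mem_simplex P b))
        (vertex_mem_simplex P i))
  refine le_of_mul_le_mul_left ?_ hd
  calc d * |normalizedLaplacian P m v X - κ|
      = |d * (normalizedLaplacian P m v X - κ)| := by rw [abs_mul, Nat.abs_cast]
    _ ≤ ρ + ((d : ℝ) + 2)⁻¹ * ((d - 1) * (d + 2) * ρ) := by
        rw [card_mul_normalizedLaplacian_sub hP hX]
        refine (abs_add_le _ _).trans (add_le_add hX' ?_)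
        rw [abs_mul, abs_of_nonneg (by positivity : 0 ≤ ((d : ℝ) + 2)⁻¹)]
        gcongr
        exact abs_sum_fiber_edgeWeight_mul_le hP hX hedge
    _ = d * ρ := by
        field_simp
        ring

/-! ### Consistency -/

/-- The averaging property passes a bound from one order to the previous one, at the cost of the
oscillation of `f` at the scale of the cells; the geometric series of these costs is summed by
starting from an order at which the bound `ε` is already available. -/
theorem HasLaplacian.abs_normalizedLaplacian_sub_le [NeZero d] {v f : Ambient d → ℝ}
    (hv : HasLaplacian P v f) (hP : AffineIndependent ℝ P) {q A : ℝ} (hq₀ : 0 ≤ q) (hq₁ : q < 1)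
    (hA : 0 ≤ A)
    (hf : ∀ m : ℕ, ∀ x ∈ simplex P, ∀ y ∈ simplex P,
      dist x y ≤ (2⁻¹ : ℝ) ^ m * Metric.diam (simplex P) → |f x - f y| ≤ A * q ^ m)
    {m : ℕ} {X : Ambient d} (hX : X ∈ interiorVertices P m) :
    |normalizedLaplacian P m v X - f X| ≤ A / (1 - q) * q ^ m := by
  have hq : 0 < 1 - q := sub_pos.2 hq₁
  refine le_of_forall_pos_le_add fun ε hε => ?_
  obtain ⟨n₀, hn₀⟩ := eventually_atTop.1 (hv.eventually_abs_sub_lt hP hε)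
  have hback : ∀ k m : ℕ, n₀ ≤ m + k → ∀ X ∈ interiorVertices P m,
      |normalizedLaplacian P m v X - f X| ≤ A / (1 - q) * q ^ m + ε := by
    intro k
    induction k with
    | zero =>
      exact fun m hm X hX => (hn₀ m hm X hX).le.trans (le_add_of_nonneg_left (by positivity))
    | succ k ih =>
      intro m hm X hX
      refine abs_normalizedLaplacian_sub_le_of_succ hP hX v fun Y hY hdist => ?_
      have hYX := hf m Y (vertices_subset_simplex (mem_interiorVertices.1 hY).1) X
        (vertices_subset_simplex (mem_interiorVertices.1 hX).1) hdist
      calc |normalizedLaplacian P (m + 1) v Y - f X|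
          ≤ |normalizedLaplacian P (m + 1) v Y - f Y| + |f Y - f X| := abs_sub_le _ _ _
        _ ≤ (A / (1 - q) * q ^ (m + 1) + ε) + A * q ^ m :=
            add_le_add (ih (m + 1) (by omega) Y hY) hYX
        _ = A / (1 - q) * q ^ m + ε := by
            field_simp
            ring
  exact hback n₀ m (Nat.le_add_left n₀ m) X hX

theorem HasLaplacian.abs_normalizedLaplacian_sub_le_of_holder [NeZero d] {v f : Ambient d → ℝ}
    (hv : HasLaplacian P v f) (hP : AffineIndependent ℝ P) {α H : ℝ} (hα : 0 < α) (hH : 0 ≤ H)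
    (hf : ∀ x ∈ simplex P, ∀ y ∈ simplex P, |f x - f y| ≤ H * dist x y ^ α)
    {m : ℕ} {X : Ambient d} (hX : X ∈ interiorVertices P m) :
    |normalizedLaplacian P m v X - f X| ≤
      H * Metric.diam (simplex P) ^ α / (1 - (2 : ℝ) ^ (-α)) * (2 : ℝ) ^ (-(m : ℝ) * α) := by
  have hpow : ∀ m : ℕ, (2 : ℝ) ^ (-(m : ℝ) * α) = ((2 : ℝ) ^ (-α)) ^ m := fun m => by
    rw [← Real.rpow_mul_natCast zero_le_two, neg_mul_comm, mul_comm]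
  rw [hpow]
  refine hv.abs_normalizedLaplacian_sub_le hP (by positivity)
    (Real.rpow_lt_one_of_one_lt_of_neg one_lt_two (neg_lt_zero.2 hα)) (by positivity)
    (fun n x hx y hy hxy => (hf x hx y hy).trans ?_) hX
  calc H * dist x y ^ α
      ≤ H * ((2⁻¹ : ℝ) ^ n * Metric.diam (simplex P)) ^ α := by gcongr
    _ = H * Metric.diam (simplex P) ^ α * ((2 : ℝ) ^ (-α)) ^ n := by
        rw [Real.mul_rpow (by positivity) Metric.diam_nonneg, ← hpow, inv_pow,
          ← Real.rpow_natCast, ← Real.rpow_neg zero_le_two, ← Real.rpow_mul zero_le_two]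
        ring

theorem continuousOn_normalizedLaplacian {u : ℝ → Ambient d → ℝ} {s : Set ℝ}
    (hu : ∀ x ∈ simplex P, ContinuousOn (fun t => u t x) s) (m : ℕ) {X : Ambient d}
    (hX : X ∈ simplex P) : ContinuousOn (fun t => normalizedLaplacian P m (u t) X) s := by
  classical
  exact continuousOn_const.mul (continuousOn_finsetSum _ fun Y hY =>
    (hu Y (vertices_subset_simplex (Finset.mem_filter.1 hY).1)).sub (hu X hX))

section HeatSolution

variable [NeZero d] {T : ℝ} {g : Ambient d → ℝ} {u f : ℝ → Ambient d → ℝ}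

theorem IsHeatSolution.eq_zero_of_mem_boundary (hu : IsHeatSolution P T g u f) (hT : 0 < T)
    {t : ℝ} (ht : t ∈ Icc 0 T) {X : Ambient d} (hX : X ∈ vertices P 0) : u t X = 0 := by
  rcases ht.2.lt_or_eq with h | rfl
  · exact hu.boundary t ⟨ht.1, h⟩ X hX
  · have hcont := (hu.continuousOn_time X (vertices_subset_simplex hX) t ht).mono
      Ico_subset_Icc_self
    have := right_nhdsWithin_Ico_neBot hT
    refine tendsto_nhds_unique hcont.tendsto (tendsto_const_nhds.congr' ?_)
    filter_upwards [self_mem_nhdsWithin] with s hs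
    exact (hu.boundary s hs X hX).symm

theorem IsHeatSolution.exists_eq_slope (hu : IsHeatSolution P T g u f) {s t : ℝ} (hs : 0 ≤ s)
    (hst : s < t) (ht : t ≤ T) {x : Ambient d} (hx : x ∈ simplex P) :
    ∃ ξ ∈ Ioo s t, f ξ x = (u t x - u s x) / (t - s) :=
  exists_hasDerivAt_eq_slope (fun τ => u τ x) (fun τ => f τ x) hst
    ((hu.continuousOn_time x hx).mono (Icc_subset_Icc hs ht))
    fun τ hτ => hu.time_deriv τ ⟨hs.trans_lt hτ.1, hτ.2.trans_le ht⟩ x hx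

theorem IsHeatSolution.abs_slope_sub_normalizedLaplacian_le (hu : IsHeatSolution P T g u f)
    {m : ℕ} {X : Ambient d} (hX : X ∈ simplex P) {M B : ℝ}
    (hB : ∀ t ∈ Ioo 0 T, |normalizedLaplacian P m (u t) X - f t X| ≤ B)
    (hM : ∀ s ∈ Ioo 0 T, ∀ t ∈ Ioo 0 T, |f s X - f t X| ≤ M * |s - t|) {s t : ℝ} (hs : 0 ≤ s)
    (hst : s < t) (ht : t ≤ T) :
    |(u t X - u s X) / (t - s) - normalizedLaplacian P m (u s) X| ≤ |M| * (t - s) + B := by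
  obtain ⟨ξ, hξ, hslope⟩ := hu.exists_eq_slope hs hst ht hX
  rw [← hslope]
  have hsub : Ioo s t ⊆ Ioo 0 T := Ioo_subset_Ioo hs ht
  have hcont : ContinuousWithinAt (fun τ => normalizedLaplacian P m (u τ) X) (Ioo s t) s :=
    (continuousOn_normalizedLaplacian hu.continuousOn_time m hX s
      ⟨hs, (hst.trans_le ht).le⟩).mono (hsub.trans Ioo_subset_Icc_self)
  have := left_nhdsWithin_Ioo_neBot hst
  refine le_of_tendsto (tendsto_const_nhds.sub hcont.tendsto).abs ?_
  filter_upwards [self_mem_nhdsWithin] with τ hτ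
  have hξτ : |ξ - τ| ≤ t - s := abs_sub_le_of_le_of_le hξ.1.le hξ.2.le hτ.1.le hτ.2.le
  calc |f ξ X - normalizedLaplacian P m (u τ) X|
      ≤ |f ξ X - f τ X| + |f τ X - normalizedLaplacian P m (u τ) X| := abs_sub_le _ _ _
    _ ≤ |M| * (t - s) + B := by
        refine add_le_add ((hM ξ (hsub hξ) τ (hsub hτ)).trans ?_) ?_
        · exact mul_le_mul (le_abs_self M) hξτ (abs_nonneg _) (abs_nonneg M)
        · rw [abs_sub_comm]
          exact hB τ (hsub hτ)

theorem IsHeatSolution.exists_abs_consistencyError_le (hu : IsHeatSolution P T g u f)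
    (hP : AffineIndependent ℝ P) (hT : 0 < T) {α H M : ℝ} (hα : 0 < α)
    (hH : ∀ t ∈ Ioo 0 T, ∀ x ∈ simplex P, ∀ y ∈ simplex P, |f t x - f t y| ≤ H * dist x y ^ α)
    (hM : ∀ s ∈ Ioo 0 T, ∀ t ∈ Ioo 0 T, ∀ x ∈ simplex P, |f s x - f t x| ≤ M * |s - t|) :
    ∃ C, 0 ≤ C ∧ ∀ m N k : ℕ, k < N → ∀ X ∈ interiorVertices P m,
      |consistencyError P m (T / N) u k X| ≤ C * (T / N + (2 : ℝ) ^ (-(m : ℝ) * α)) := by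
  set A := |H| * Metric.diam (simplex P) ^ α / (1 - (2 : ℝ) ^ (-α))
  have hA₀ : 0 ≤ A := div_nonneg (by positivity) (sub_nonneg.2
    (Real.rpow_lt_one_of_one_lt_of_neg one_lt_two (neg_lt_zero.2 hα)).le)
  refine ⟨|M| + A, by positivity, fun m N k hk X hX => ?_⟩
  obtain ⟨hXm, hX₀⟩ := mem_interiorVertices.1 hX
  have hXK := vertices_subset_simplex hXm
  have hN : (0 : ℝ) < N := Nat.cast_pos.2 (Nat.zero_lt_of_lt hk)
  have hstep : ((k + 1 : ℕ) : ℝ) * (T / N) - k * (T / N) = T / N := by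
    push_cast
    ring
  have hle : ((k + 1 : ℕ) : ℝ) * (T / N) ≤ T := by
    rw [mul_div_left_comm]
    exact mul_le_of_le_one_right hT.le ((div_le_one hN).2 (Nat.cast_le.2 hk))
  have herror := hu.abs_slope_sub_normalizedLaplacian_le hXK
    (fun t ht => (hu.laplacian t ht).abs_normalizedLaplacian_sub_le_of_holder hP hα
      (abs_nonneg H) (fun x hx y hy => (hH t ht x hx y hy).trans
        (mul_le_mul_of_nonneg_right (le_abs_self H) (by positivity))) hX)
    (fun s hs t ht => hM s hs t ht X hXK) (s := k * (T / N)) (t := ((k + 1 : ℕ) : ℝ) * (T / N))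
    (by positivity) (by gcongr; exact k.lt_succ_self) hle
  rw [hstep] at herror
  rw [consistencyError, if_neg hX₀]
  have hpos : 0 ≤ T / N := by positivity
  have hpos' : (0 : ℝ) ≤ 2 ^ (-(m : ℝ) * α) := by positivity
  nlinarith [mul_nonneg (abs_nonneg M) hpos', mul_nonneg hA₀ hpos]

end HeatSolution

/-! ### Stability -/

theorem sum_sq_sum_sub {ι R : Type*} [Fintype ι] [CommRing R] (x : ι → R) :
    ∑ i, (∑ j, (x j - x i)) ^ 2 = -(Fintype.card ι * ∑ i, x i * ∑ j, (x j - x i)) := by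
  have hsum : ∀ i, ∑ j, (x j - x i) = ∑ j, x j - Fintype.card ι * x i := fun i => by simp
  have htotal : ∑ i, ∑ j, (x j - x i) = 0 := by
    simp only [hsum, Finset.sum_sub_distrib, ← Finset.mul_sum, Finset.sum_const, Finset.card_univ,
      nsmul_eq_mul, sub_self]
  calc ∑ i, (∑ j, (x j - x i)) ^ 2
      = ∑ i, ((∑ j, x j) * ∑ j, (x j - x i) - Fintype.card ι * (x i * ∑ j, (x j - x i))) :=
        Finset.sum_congr rfl fun i _ => by rw [hsum]; ring
    _ = -(Fintype.card ι * ∑ i, x i * ∑ j, (x j - x i)) := by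
        rw [Finset.sum_sub_distrib, ← Finset.mul_sum, htotal, mul_zero, zero_sub,
          ← Finset.mul_sum]

theorem sum_mul_graphLaplacian (hP : AffineIndependent ℝ P) (m : ℕ) (v : Ambient d → ℝ) :
    ∑ X ∈ vertices P m, v X * graphLaplacian P m v X =
      ∑ c ∈ corners d m, v (cornerPoint P c) * cellLaplacian P v c := by
  rw [← sum_vertices_fiber P]
  refine Finset.sum_congr rfl fun X _ => ?_
  rw [graphLaplacian_eq hP, Finset.mul_sum]
  exact Finset.sum_congr rfl fun c hc => by rw [(mem_fiber.1 hc).2]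

theorem sum_sq_cellLaplacian (P : Fin d → Ambient d) (m : ℕ) (v : Ambient d → ℝ) :
    ∑ c ∈ corners d m, cellLaplacian P v c ^ 2 =
      -(d * ∑ c ∈ corners d m, v (cornerPoint P c) * cellLaplacian P v c) := by
  rw [sum_corners, sum_corners, Finset.mul_sum, ← Finset.sum_neg_distrib]
  refine Finset.sum_congr rfl fun w _ => ?_
  have hcell := sum_sq_sum_sub fun i => v (wordMap P w (P i))
  rwa [Fintype.card_fin] at hcell

/-- The factor `2` is the number of cells of order `m` that meet at an interior vertex. -/
theorem sum_sq_graphLaplacian_le (hP : AffineIndependent ℝ P) (m : ℕ) (v : Ambient d → ℝ) :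
    ∑ X ∈ interiorVertices P m, graphLaplacian P m v X ^ 2 ≤
      -(2 * d * ∑ X ∈ vertices P m, v X * graphLaplacian P m v X) := by
  calc ∑ X ∈ interiorVertices P m, graphLaplacian P m v X ^ 2
      ≤ ∑ X ∈ interiorVertices P m, 2 * ∑ c ∈ fiber P m X, cellLaplacian P v c ^ 2 := by
        refine Finset.sum_le_sum fun X hX => ?_
        have hCauchy := sq_sum_le_card_mul_sum_sq (s := fiber P m X) (f := cellLaplacian P v)
        rwa [card_fiber hP hX, Nat.cast_ofNat, ← graphLaplacian_eq hP] at hCauchy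
    _ ≤ ∑ X ∈ vertices P m, 2 * ∑ c ∈ fiber P m X, cellLaplacian P v c ^ 2 :=
        Finset.sum_le_sum_of_subset_of_nonneg (fun X hX => (mem_interiorVertices.1 hX).1)
          fun X _ _ => mul_nonneg zero_le_two (Finset.sum_nonneg fun _ _ => sq_nonneg _)
    _ = -(2 * d * ∑ X ∈ vertices P m, v X * graphLaplacian P m v X) := by
        rw [← Finset.mul_sum, sum_vertices_fiber, sum_sq_cellLaplacian, ← sum_mul_graphLaplacian hP]
        ring

theorem sum_interiorVertices_eq (P : Fin d → Ambient d) (m : ℕ) {F : Ambient d → ℝ}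
    (hF : ∀ X ∈ vertices P 0, F X = 0) :
    ∑ X ∈ interiorVertices P m, F X = ∑ X ∈ vertices P m, F X :=
  Finset.sum_subset (fun _ hX => (mem_interiorVertices.1 hX).1) fun X hX hX' =>
    hF X (by_contra fun hX₀ => hX' (mem_interiorVertices.2 ⟨hX, hX₀⟩))

theorem sum_sq_add_mul_graphLaplacian_le [NeZero d] (hP : AffineIndependent ℝ P) (m : ℕ)
    {v : Ambient d → ℝ} (hv : ∀ X ∈ vertices P 0, v X = 0) {τ : ℝ} (hτ₀ : 0 ≤ τ)
    (hτ : τ * d ≤ 1) :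
    ∑ X ∈ interiorVertices P m, (v X + τ * graphLaplacian P m v X) ^ 2 ≤
      ∑ X ∈ vertices P m, v X ^ 2 := by
  have hd : 0 < (d : ℝ) := Nat.cast_pos.2 (NeZero.pos d)
  have henergy := sum_sq_graphLaplacian_le hP m v
  set R := ∑ X ∈ interiorVertices P m, graphLaplacian P m v X ^ 2 with hR
  set Q := ∑ X ∈ vertices P m, v X * graphLaplacian P m v X with hQ
  have hR₀ : 0 ≤ R := Finset.sum_nonneg fun _ _ => sq_nonneg _
  have hexpand : ∑ X ∈ interiorVertices P m, (v X + τ * graphLaplacian P m v X) ^ 2 =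
      ∑ X ∈ vertices P m, v X ^ 2 + τ * (2 * Q + τ * R) := by
    rw [hQ, hR, ← sum_interiorVertices_eq P m fun X hX => by simp [hv X hX],
      ← sum_interiorVertices_eq P m fun X hX => by simp [hv X hX]]
    simp only [Finset.mul_sum, ← Finset.sum_add_distrib]
    exact Finset.sum_congr rfl fun X _ => by ring
  have hdissipation : 2 * Q + τ * R ≤ 0 := by
    refine nonpos_of_mul_nonpos_right ?_ hd
    linarith [mul_le_mul_of_nonneg_right hτ hR₀]
  rw [hexpand]
  exact add_le_of_nonpos_right (mul_nonpos_of_nonneg_of_nonpos hτ₀ hdissipation)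

/-- The discrete `ℓ²` norm `(d^{-m} ∑_{X ∈ V_m} |w X|²)^{1/2}` on functions on `V_m`, whose maximum
over the time steps is `normTwoInfty`. -/
def vertexNorm (P : Fin d → Ambient d) (m : ℕ) (w : Ambient d → ℝ) : ℝ :=
  √(((d : ℝ) ^ m)⁻¹ * ∑ X ∈ vertices P m, |w X| ^ 2)

theorem vertexNorm_eq_mul_norm (P : Fin d → Ambient d) (m : ℕ) (w : Ambient d → ℝ) :
    vertexNorm P m w =
      √((d : ℝ) ^ m)⁻¹ * ‖WithLp.toLp 2 fun X : vertices P m => w X‖ := by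
  rw [vertexNorm, Real.sqrt_mul (by positivity), EuclideanSpace.norm_eq,
    ← Finset.sum_coe_sort (vertices P m)]
  rfl

theorem vertexNorm_add_le (P : Fin d → Ambient d) (m : ℕ) (v w : Ambient d → ℝ) :
    vertexNorm P m (v + w) ≤ vertexNorm P m v + vertexNorm P m w := by
  have hadd : (WithLp.toLp 2 fun X : vertices P m => (v + w) X) =
      (WithLp.toLp 2 fun X : vertices P m => v X) + WithLp.toLp 2 fun X : vertices P m => w X :=
    rfl
  rw [vertexNorm_eq_mul_norm, vertexNorm_eq_mul_norm, vertexNorm_eq_mul_norm, hadd, ← mul_add]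
  exact mul_le_mul_of_nonneg_left (norm_add_le _ _) (Real.sqrt_nonneg _)

theorem vertexNorm_smul (P : Fin d → Ambient d) (m : ℕ) (a : ℝ) (w : Ambient d → ℝ) :
    vertexNorm P m (a • w) = |a| * vertexNorm P m w := by
  rw [vertexNorm_eq_mul_norm, vertexNorm_eq_mul_norm, mul_left_comm, ← Real.norm_eq_abs,
    ← norm_smul]
  rfl

theorem vertexNorm_le_of_abs_le [NeZero d] (P : Fin d → Ambient d) (m : ℕ) {w : Ambient d → ℝ}
    {B : ℝ} (hB : 0 ≤ B) (hw : ∀ X ∈ vertices P m, |w X| ≤ B) : vertexNorm P m w ≤ √d * B := by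
  have hd : 0 < (d : ℝ) := Nat.cast_pos.2 (NeZero.pos d)
  rw [vertexNorm, ← Real.sqrt_sq hB, ← Real.sqrt_mul hd.le]
  refine Real.sqrt_le_sqrt ?_
  rw [inv_mul_le_iff₀ (by positivity), ← mul_assoc]
  calc ∑ X ∈ vertices P m, |w X| ^ 2
      ≤ (vertices P m).card • B ^ 2 :=
        Finset.sum_le_card_nsmul _ _ _ fun X hX => pow_le_pow_left₀ (abs_nonneg _) (hw X hX) 2
    _ ≤ d ^ m * d * B ^ 2 := by
        rw [nsmul_eq_mul]
        gcongr
        exact_mod_cast card_vertices_le P m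

theorem vertexNorm_le_normTwoInfty (P : Fin d → Ambient d) (m : ℕ) {K k : ℕ} (hk : k < K)
    (w : ℕ → Ambient d → ℝ) : vertexNorm P m (w k) ≤ normTwoInfty P m K w :=
  le_ciSup (f := fun k : Fin K => vertexNorm P m (w k)) (finite_range _).bddAbove ⟨k, hk⟩

theorem normTwoInfty_nonneg (P : Fin d → Ambient d) (m K : ℕ) (w : ℕ → Ambient d → ℝ) :
    0 ≤ normTwoInfty P m K w :=
  Real.iSup_nonneg fun _ => Real.sqrt_nonneg _

theorem normTwoInfty_le {m K : ℕ} {w : ℕ → Ambient d → ℝ} {B : ℝ} (hB : 0 ≤ B)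
    (h : ∀ k < K, vertexNorm P m (w k) ≤ B) : normTwoInfty P m K w ≤ B :=
  Real.iSup_le (fun k => h k k.2) hB

open Classical in
/-- One step of length `h` of the explicit Euler scheme: `v + h (d/2) (d+2)^m Δ_m v` off the
boundary `V_0`, where the value is set to `0`. -/
def eulerStep (P : Fin d → Ambient d) (m : ℕ) (h : ℝ) (v : Ambient d → ℝ) (X : Ambient d) : ℝ :=
  if X ∈ vertices P 0 then 0 else v X + h * normalizedLaplacian P m v X

theorem CFL.vertexNorm_eulerStep_le [NeZero d] {m : ℕ} {h : ℝ} (hcfl : CFL d m h) (hh : 0 ≤ h)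
    (hP : AffineIndependent ℝ P) {v : Ambient d → ℝ} (hv : ∀ X ∈ vertices P 0, v X = 0) :
    vertexNorm P m (eulerStep P m h v) ≤ vertexNorm P m v := by
  have hd : 0 < (d : ℝ) := Nat.cast_pos.2 (NeZero.pos d)
  have hτ : h * ((d : ℝ) / 2 * ((d : ℝ) + 2) ^ m) * d ≤ 1 := by
    rw [CFL, le_div_iff₀ (by positivity)] at hcfl
    linarith
  refine Real.sqrt_le_sqrt (mul_le_mul_of_nonneg_left ?_ (by positivity))
  simp only [sq_abs]
  refine le_trans (le_of_eq ?_) (sum_sq_add_mul_graphLaplacian_le hP m hv (by positivity) hτ)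
  rw [← sum_interiorVertices_eq P m fun X hX => by rw [eulerStep, if_pos hX, sq, zero_mul]]
  refine Finset.sum_congr rfl fun X hX => ?_
  rw [eulerStep, if_neg (mem_interiorVertices.1 hX).2, normalizedLaplacian, mul_assoc h]

theorem normalizedLaplacian_sub (P : Fin d → Ambient d) (m : ℕ) (v w : Ambient d → ℝ)
    (X : Ambient d) : normalizedLaplacian P m (v - w) X =
      normalizedLaplacian P m v X - normalizedLaplacian P m w X := by
  simp only [normalizedLaplacian, graphLaplacian, ← mul_sub, ← Finset.sum_sub_distrib,
    Pi.sub_apply, sub_sub_sub_comm]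

theorem eulerScheme_eq_zero_of_mem_boundary (m : ℕ) (h : ℝ) (g : Ambient d → ℝ) (k : ℕ)
    {X : Ambient d} (hX : X ∈ vertices P 0) : eulerScheme P m h g k X = 0 := by
  cases k <;> exact if_pos hX

theorem schemeError_succ (P : Fin d → Ambient d) (m : ℕ) {h : ℝ} (hh : h ≠ 0)
    (g : Ambient d → ℝ) {u : ℝ → Ambient d → ℝ} {k : ℕ}
    (hu : ∀ X ∈ vertices P 0, u ((k + 1 : ℕ) * h) X = 0) :
    schemeError P m h g u (k + 1) =
      eulerStep P m h (schemeError P m h g u k) + h • consistencyError P m h u k := by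
  funext X
  by_cases hX : X ∈ vertices P 0
  · simp only [schemeError, eulerStep, consistencyError, Pi.add_apply, Pi.smul_apply, if_pos hX,
      hu X hX, eulerScheme_eq_zero_of_mem_boundary m h g (k + 1) hX, sub_zero, smul_zero, add_zero]
  · have hLaplacian : normalizedLaplacian P m (schemeError P m h g u k) X =
        normalizedLaplacian P m (u (k * h)) X -
          normalizedLaplacian P m (eulerScheme P m h g k) X :=
      normalizedLaplacian_sub P m _ _ X
    simp only [Pi.add_apply, Pi.smul_apply, smul_eq_mul, eulerStep, consistencyError, if_neg hX,
      hLaplacian, schemeError, eulerScheme]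
    field_simp
    ring

section HeatSolution

variable [NeZero d] {T : ℝ} {g : Ambient d → ℝ} {u f : ℝ → Ambient d → ℝ}

theorem IsHeatSolution.schemeError_eq_zero_of_mem_boundary (hu : IsHeatSolution P T g u f)
    (hT : 0 < T) (m : ℕ) {h : ℝ} {k : ℕ} (hk : k * h ∈ Icc 0 T) {X : Ambient d}
    (hX : X ∈ vertices P 0) : schemeError P m h g u k X = 0 := by
  rw [schemeError, eulerScheme_eq_zero_of_mem_boundary m h g k hX,
    hu.eq_zero_of_mem_boundary hT hk hX, sub_zero]

theorem IsHeatSolution.schemeError_zero (hu : IsHeatSolution P T g u f) (hT : 0 < T) {m : ℕ}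
    (h : ℝ) {X : Ambient d} (hX : X ∈ vertices P m) : schemeError P m h g u 0 X = 0 := by
  by_cases hX₀ : X ∈ vertices P 0
  · exact hu.schemeError_eq_zero_of_mem_boundary hT m (by simp [hT.le]) hX₀
  · simp only [schemeError, eulerScheme, if_neg hX₀, Nat.cast_zero, zero_mul,
      hu.initial X (vertices_subset_simplex hX), sub_self]

theorem IsHeatSolution.vertexNorm_schemeError_le (hu : IsHeatSolution P T g u f)
    (hP : AffineIndependent ℝ P) (hT : 0 < T) {m : ℕ} {h : ℝ} (hh : 0 < h) (hcfl : CFL d m h)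
    {B : ℝ} (k : ℕ) (hk : k * h ≤ T)
    (hB : ∀ j < k, vertexNorm P m (consistencyError P m h u j) ≤ B) :
    vertexNorm P m (schemeError P m h g u k) ≤ k * h * B := by
  induction k with
  | zero =>
    have hsum : ∑ X ∈ vertices P m, |schemeError P m h g u 0 X| ^ 2 = 0 :=
      Finset.sum_eq_zero fun X hX => by rw [hu.schemeError_zero hT h hX, abs_zero, sq, zero_mul]
    rw [vertexNorm, hsum, mul_zero, Real.sqrt_zero, Nat.cast_zero, zero_mul, zero_mul]
  | succ k ih =>
    have hk' : k * h ≤ T := le_trans (by gcongr; exact k.le_succ) hk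
    have hstable := hcfl.vertexNorm_eulerStep_le hh.le hP fun X hX =>
      hu.schemeError_eq_zero_of_mem_boundary hT m ⟨by positivity, hk'⟩ hX
    have hu₀ : ∀ X ∈ vertices P 0, u ((k + 1 : ℕ) * h) X = 0 := fun X hX =>
      hu.eq_zero_of_mem_boundary hT ⟨by positivity, hk⟩ hX
    calc vertexNorm P m (schemeError P m h g u (k + 1))
        ≤ vertexNorm P m (eulerStep P m h (schemeError P m h g u k)) +
            |h| * vertexNorm P m (consistencyError P m h u k) := by
          rw [schemeError_succ P m hh.ne' g hu₀, ← vertexNorm_smul]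
          exact vertexNorm_add_le P m _ _
      _ ≤ k * h * B + h * B := by
          rw [abs_of_pos hh]
          exact add_le_add (hstable.trans (ih hk' fun j hj => hB j (hj.trans k.lt_succ_self)))
            (mul_le_mul_of_nonneg_left (hB k k.lt_succ_self) hh.le)
      _ = (k + 1 : ℕ) * h * B := by
          push_cast
          ring

theorem IsHeatSolution.normTwoInfty_schemeError_le (hu : IsHeatSolution P T g u f)
    (hP : AffineIndependent ℝ P) (hT : 0 < T) {m N : ℕ} (hN : 1 ≤ N) (hcfl : CFL d m (T / N)) :
    normTwoInfty P m (N + 1) (schemeError P m (T / N) g u) ≤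
      T * normTwoInfty P m N (consistencyError P m (T / N) u) := by
  have hN' : (0 : ℝ) < N := Nat.cast_pos.2 hN
  have hB := normTwoInfty_nonneg P m N (consistencyError P m (T / N) u)
  refine normTwoInfty_le (mul_nonneg hT.le hB) fun k hk => ?_
  have hkN : k ≤ N := Nat.le_of_lt_succ hk
  have hkT : k * (T / N) ≤ T := by
    rw [mul_div_left_comm]
    exact mul_le_of_le_one_right hT.le ((div_le_one hN').2 (Nat.cast_le.2 hkN))
  refine (hu.vertexNorm_schemeError_le hP hT (div_pos hT hN') hcfl k hkT fun j hj =>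
    vertexNorm_le_normTwoInfty P m (hj.trans_le hkN) _).trans ?_
  exact mul_le_mul_of_nonneg_right hkT hB

end HeatSolution

/-! ### Convergence -/

theorem eventually_cflLimit (d : ℕ) (T : ℝ) :
    ∀ᶠ q in cflLimit d T, 1 ≤ q.2 ∧ CFL d q.1 (T / q.2) :=
  mem_inf_of_right (mem_principal_self _)

theorem tendsto_fst_cflLimit (d : ℕ) (T : ℝ) : Tendsto Prod.fst (cflLimit d T) atTop :=
  tendsto_comap.mono_left inf_le_left

theorem tendsto_step_cflLimit (d : ℕ) {T : ℝ} (hT : 0 ≤ T) :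
    Tendsto (fun q : ℕ × ℕ => T / q.2) (cflLimit d T) (𝓝 0) := by
  have hd : (1 : ℝ) < d + 2 := by
    linarith [Nat.cast_nonneg (α := ℝ) d]
  have hbound : Tendsto (fun m : ℕ => 2 / (d : ℝ) ^ 2 / ((d : ℝ) + 2) ^ m) atTop (𝓝 0) :=
    (tendsto_pow_atTop_atTop_of_one_lt hd).const_div_atTop _
  refine squeeze_zero' (Eventually.of_forall fun q => by positivity) ?_
    (hbound.comp (tendsto_fst_cflLimit d T))
  filter_upwards [eventually_cflLimit d T] with q hq
  exact (le_div_iff₀ (by positivity)).2 hq.2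

theorem tendsto_two_rpow_neg_mul {α : ℝ} (hα : 0 < α) :
    Tendsto (fun m : ℕ => (2 : ℝ) ^ (-(m : ℝ) * α)) atTop (𝓝 0) :=
  (tendsto_rpow_atBot_of_base_gt_one 2 one_lt_two).comp
    ((tendsto_neg_atTop_atBot.comp tendsto_natCast_atTop_atTop).atBot_mul_const hα)

section HeatSolution

variable [NeZero d] {T : ℝ} {g : Ambient d → ℝ} {u f : ℝ → Ambient d → ℝ}

theorem IsHeatSolution.tendsto_schemeError (hu : IsHeatSolution P T g u f)
    (hP : AffineIndependent ℝ P) (hT : 0 < T)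
    (hconsistent : Tendsto (fun q : ℕ × ℕ =>
      normTwoInfty P q.1 q.2 (consistencyError P q.1 (T / q.2) u)) (cflLimit d T) (𝓝 0)) :
    Tendsto (fun q : ℕ × ℕ => normTwoInfty P q.1 (q.2 + 1) (schemeError P q.1 (T / q.2) g u))
      (cflLimit d T) (𝓝 0) := by
  refine squeeze_zero' (Eventually.of_forall fun q => normTwoInfty_nonneg _ _ _ _) ?_
    (mul_zero T ▸ hconsistent.const_mul T)
  filter_upwards [eventually_cflLimit d T] with q hq
  exact hu.normTwoInfty_schemeError_le hP hT hq.1 hq.2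

theorem normTwoInfty_consistencyError_le {m N : ℕ} {h B : ℝ} (hB : 0 ≤ B)
    (hinterior : ∀ k < N, ∀ X ∈ interiorVertices P m, |consistencyError P m h u k X| ≤ B) :
    normTwoInfty P m N (consistencyError P m h u) ≤ √d * B := by
  refine normTwoInfty_le (by positivity) fun k hk =>
    vertexNorm_le_of_abs_le P m hB fun X hX => ?_
  by_cases hX₀ : X ∈ vertices P 0
  · rwa [consistencyError, if_pos hX₀, abs_zero]
  · exact hinterior k hk X (mem_interiorVertices.2 ⟨hX, hX₀⟩)

theorem IsHeatSolution.normTwoInfty_schemeError_le_of_consistencyError_le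
    (hu : IsHeatSolution P T g u f) (hP : AffineIndependent ℝ P) (hT : 0 < T) {m N : ℕ}
    (hN : 1 ≤ N) (hcfl : CFL d m (T / N)) {B : ℝ} (hB : 0 ≤ B)
    (hinterior : ∀ k < N, ∀ X ∈ interiorVertices P m,
      |consistencyError P m (T / N) u k X| ≤ B) :
    normTwoInfty P m (N + 1) (schemeError P m (T / N) g u) ≤ T * (√d * B) :=
  (hu.normTwoInfty_schemeError_le hP hT hN hcfl).trans
    (mul_le_mul_of_nonneg_left (normTwoInfty_consistencyError_le hB hinterior) hT.le)

theorem IsHeatSolution.exists_error_le (hu : IsHeatSolution P T g u f)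
    (hP : AffineIndependent ℝ P) (hT : 0 < T) {α H M : ℝ} (hα : 0 < α)
    (hH : ∀ t ∈ Ioo 0 T, ∀ x ∈ simplex P, ∀ y ∈ simplex P, |f t x - f t y| ≤ H * dist x y ^ α)
    (hM : ∀ s ∈ Ioo 0 T, ∀ t ∈ Ioo 0 T, ∀ x ∈ simplex P, |f s x - f t x| ≤ M * |s - t|) :
    ∃ C : ℝ, ∀ m N : ℕ, 1 ≤ N →
      (∀ k < N, ∀ X ∈ interiorVertices P m,
        |consistencyError P m (T / N) u k X| ≤ C * (T / N + (2 : ℝ) ^ (-(m : ℝ) * α))) ∧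
      (CFL d m (T / N) →
        normTwoInfty P m (N + 1) (schemeError P m (T / N) g u) ≤
          C * (T / N + (2 : ℝ) ^ (-(m : ℝ) * α))) := by
  obtain ⟨C, hC₀, hC⟩ := hu.exists_abs_consistencyError_le hP hT hα hH hM
  refine ⟨max C (T * (√d * C)), fun m N hN => ?_⟩
  have hrate : 0 ≤ T / N + (2 : ℝ) ^ (-(m : ℝ) * α) := by positivity
  refine ⟨fun k hk X hX => (hC m N k hk X hX).trans ?_, fun hcfl => ?_⟩
  · exact mul_le_mul_of_nonneg_right (le_max_left _ _) hrate
  · refine (hu.normTwoInfty_schemeError_le_of_consistencyError_le hP hT hN hcfl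
      (mul_nonneg hC₀ hrate) fun k hk X hX => hC m N k hk X hX).trans ?_
    rw [← mul_assoc, ← mul_assoc, mul_assoc T]
    exact mul_le_mul_of_nonneg_right (le_max_right _ _) hrate

theorem IsHeatSolution.tendsto_schemeError_of_holder (hu : IsHeatSolution P T g u f)
    (hP : AffineIndependent ℝ P) (hT : 0 < T) {α H M : ℝ} (hα : 0 < α)
    (hH : ∀ t ∈ Ioo 0 T, ∀ x ∈ simplex P, ∀ y ∈ simplex P, |f t x - f t y| ≤ H * dist x y ^ α)
    (hM : ∀ s ∈ Ioo 0 T, ∀ t ∈ Ioo 0 T, ∀ x ∈ simplex P, |f s x - f t x| ≤ M * |s - t|) :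
    Tendsto (fun q : ℕ × ℕ => normTwoInfty P q.1 (q.2 + 1) (schemeError P q.1 (T / q.2) g u))
      (cflLimit d T) (𝓝 0) := by
  obtain ⟨C, hC⟩ := hu.exists_error_le hP hT hα hH hM
  have hrate := ((tendsto_step_cflLimit d hT.le).add
    ((tendsto_two_rpow_neg_mul hα).comp (tendsto_fst_cflLimit d T))).const_mul C
  rw [add_zero, mul_zero] at hrate
  refine squeeze_zero' (Eventually.of_forall fun q => normTwoInfty_nonneg _ _ _ _) ?_ hrate
  filter_upwards [eventually_cflLimit d T] with q hq
  exact (hC q.1 q.2 hq.1).2 hq.2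

end HeatSolution

end SierpinskiHeat

end

theorem mainTheorem1 (d : ℕ) [NeZero d] (P : Fin d → Ambient d) (hP : AffineIndependent ℝ P)
    (T : ℝ) (hT : 0 < T) (g : Ambient d → ℝ) (u f : ℝ → Ambient d → ℝ)
    (hu : IsHeatSolution P T g u f) :
    -- if the scheme is consistent for `u`, then it is convergent under the CFL condition
    (Tendsto (fun q : ℕ × ℕ => normTwoInfty P q.1 q.2 (consistencyError P q.1 (T / q.2) u))
        (cflLimit d T) (𝓝 0) →
      Tendsto (fun q : ℕ × ℕ => normTwoInfty P q.1 (q.2 + 1) (schemeError P q.1 (T / q.2) g u))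
        (cflLimit d T) (𝓝 0)) ∧
    -- if `Δu` is Hölder in space and `∂u/∂t` is Lipschitz in time (both are `f`), then the scheme
    -- is consistent and convergent, with rates
    ∀ α H M : ℝ, 0 < α →
      (∀ t ∈ Ioo 0 T, ∀ x ∈ simplex P, ∀ y ∈ simplex P, |f t x - f t y| ≤ H * dist x y ^ α) →
      (∀ s ∈ Ioo 0 T, ∀ t ∈ Ioo 0 T, ∀ x ∈ simplex P, |f s x - f t x| ≤ M * |s - t|) →
      (∃ C : ℝ, ∀ m N : ℕ, 1 ≤ N →
        (∀ k < N, ∀ X ∈ interiorVertices P m,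
          |consistencyError P m (T / N) u k X| ≤ C * (T / N + (2 : ℝ) ^ (-(m : ℝ) * α))) ∧
        (CFL d m (T / N) →
          normTwoInfty P m (N + 1) (schemeError P m (T / N) g u) ≤
            C * (T / N + (2 : ℝ) ^ (-(m : ℝ) * α)))) ∧
      Tendsto (fun q : ℕ × ℕ => normTwoInfty P q.1 (q.2 + 1) (schemeError P q.1 (T / q.2) g u))
        (cflLimit d T) (𝓝 0) := by
  refine ⟨hu.tendsto_schemeError hP hT, fun α H M hα hH hM => ⟨?_, ?_⟩⟩
  · exact hu.exists_error_le hP hT hα hH hM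
  · exact hu.tendsto_schemeError_of_holder hP hT hα hH hM
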